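/- Let $\sigma=\{\sigma_z\}_{z\in\mathbb Z}$ be independent identically distributed, strictly positive real random variables with law $\mathbf P$, and put $L(x) := 1/\mathbf P(\sigma_0 > x)$. Assume that $L$ is finite and slowly varying at infinity, i.e. $\lim_{u\to\infty} L(uv)/L(u) = 1$ for every $v>0$. Given $\sigma$, let $\{X_s\}_{s\ge 0}$ be the Bouchaud trap model on $\mathbb Z$ in the landscape $\sigma$: the continuous-time Markov chain with transition rates $w_{z\to y} = \frac{1}{2\sigma_z}$ if $|z-y|=1$ and $w_{z\to y}=0$ otherwise (that is, each visit to a site $z$ lasts an independent exponential time with mean $\sigma_z$, after which the chain moves to one of the two nearest neighbours of $z$, chosen uniformly at random). Let $P_\sigma$ denote its law when $X_0=0$. For $t\ge 0$ let $$\ell_t := \min\{s\ge 0 : s\,L(s)\ge t\},$$ $$Z_t^{(1)} := \min\{z\in\mathbb Z : z>0,\ \sigma_z>\ell_t\},\qquad Z_t^{(2)} := \max\{z\in\mathbb Z : z<0,\ \sigma_z>\ell_t\},$$ both of which exist $\mathbf P$-almost surely, and let $\Gamma_t := \{Z_t^{(1)},Z_t^{(2)}\}$. Then, as $t\to\infty$,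 $$P_\sigma(X_t\in\Gamma_t)\to 1\quad\text{in }\mathbf P\text{-probability},$$ i.e. for every $\varepsilon>0$, $\mathbf P\big(|P_\sigma(X_t\in\Gamma_t)-1|\ge\varepsilon\big)\to 0$. -/

import Mathlib

open MeasureTheory ProbabilityTheory Filter Topology

noncomputable section

namespace Bouchaud

/-! ### The Bouchaud trap model on `ℤ` in a fixed trapping landscape `s : ℤ → ℝ`

The continuous-time Markov chain started at `0` with jump rates `1 / (2 * s z)` from `z` to each of
`z - 1` and `z + 1` is built from its jump chain and its holding times: the jump chain is the simple
random walk, and each visit to `z` lasts an independent exponential time of mean `s z`, that is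
`s z` times a standard exponential variable. -/

/-- The uniform distribution on the two steps `-1` and `1`. -/
def stepLaw : Measure ℤ :=
  (PMF.uniformOfFinset ({-1, 1} : Finset ℤ) (Finset.insert_nonempty _ _)).toMeasure

instance : IsProbabilityMeasure stepLaw := by
  unfold stepLaw; infer_instance

instance : IsProbabilityMeasure (expMeasure 1) :=
  isProbabilityMeasure_expMeasure one_pos

/-- The law of the driving noise: an i.i.d. sequence of independent pairs, made of a uniform `±1`
step and an exponential variable of mean `1`. -/
def noiseLaw : Measure (ℕ → ℤ × ℝ) :=
  Measure.infinitePi (fun _ => stepLaw.prod (expMeasure 1))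

instance : IsProbabilityMeasure noiseLaw := by
  unfold noiseLaw; infer_instance

/-- The simple random walk on `ℤ` from `0`. -/
def walk (w : ℕ → ℤ × ℝ) (n : ℕ) : ℤ := ∑ k ∈ Finset.range n, (w k).1

/-- The time of the `n`-th jump (with `jumpTime s w 0 = 0`); the holding time at the `k`-th visited
site `walk w k` is exponential with mean `s (walk w k)`. -/
def jumpTime (s : ℤ → ℝ) (w : ℕ → ℤ × ℝ) (n : ℕ) : ℝ :=
  ∑ k ∈ Finset.range n, s (walk w k) * (w k).2

/-- The number of jumps made up to time `t` : the least `n` with `t < jumpTime s w (n + 1)`. Since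
the walk is recurrent, such an `n` exists for almost every `w` when the landscape is positive. -/
def jumpCount (s : ℤ → ℝ) (w : ℕ → ℤ × ℝ) (t : ℝ) : ℕ := sInf {n : ℕ | t < jumpTime s w (n + 1)}

/-- The Bouchaud trap model `X_t` in the landscape `s`, started at `0`. -/
def process (s : ℤ → ℝ) (w : ℕ → ℤ × ℝ) (t : ℝ) : ℤ := walk w (jumpCount s w t)

/-- The quenched probability `P_s (X_t ∈ A)`. -/
def quenchedProb (s : ℤ → ℝ) (t : ℝ) (A : Set ℤ) : ℝ :=
  noiseLaw.real {w | process s w t ∈ A}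

/-! ### The scales and the localisation sites -/

/-- `L x = 1 / P (Y > x)` for a real random variable `Y` (the trap value at the origin). -/
def invTail {Ω : Type*} [MeasurableSpace Ω] (P : Measure Ω) (Y : Ω → ℝ) (x : ℝ) : ℝ :=
  1 / P.real {ω | x < Y ω}

/-- Slow variation at infinity. -/
def SlowlyVarying (L : ℝ → ℝ) : Prop :=
  ∀ v : ℝ, 0 < v → Tendsto (fun u => L (u * v) / L u) atTop (𝓝 1)

/-- The level `ℓ_t = min {x ≥ 0 : x L(x) ≥ t}`. The minimum exists as `L` is right-continuous,
non-decreasing and unbounded, so it is the infimum. -/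
def level (L : ℝ → ℝ) (t : ℝ) : ℝ := sInf {x : ℝ | 0 ≤ x ∧ t ≤ x * L x}

/-- The set `{Z¹, Z²}`, where `Z¹` is the least `z > 0` and `Z²` the greatest `z < 0` whose trap
value exceeds the level `l`. -/
def localisationSet (s : ℤ → ℝ) (l : ℝ) : Set ℤ :=
  {z | IsLeast {y : ℤ | 0 < y ∧ l < s y} z ∨ IsGreatest {y : ℤ | y < 0 ∧ l < s y} z}

end Bouchaud

end

noncomputable section

namespace Bouchaud

section

open scoped ENNReal

/-! ### The step law and the exponential law -/

/-! Write `l` for the level at time `t` and `q` for the probability that a trap exceeds `l`, so that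
`l / q` is of order `t` (`level_bounds`). The nearest traps exceeding `l` on either side of the
origin lie at distance of order `1 / q`. Slow variation has two effects. A trap exceeding `l` most
likely exceeds `K * l` for any fixed `K`, and the mean of a trap restricted to values at most `l` is
`o(l * q)` (`truncMean_isLittleO`), so all the other traps in a window of width of order `1 / q`
have total depth `o(l)`.

For a fixed landscape and a finite target `G`, the process can be outside `G` at time `t` in two
ways. Either it has not reached `G` by then, which Markov's inequality bounds by the truncated mean
hitting time divided by `t`; or its last visit to some `z ∈ G` ended at a time `u ≤ t` and it has
not been back since. The visits to `z` end with intensity at most `1 / s z` in time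
(`tsum_lintegral_visit_end_le`), so integrating over `u` bounds the second case by the truncated
mean return time divided by `s z`. No convergence to equilibrium is needed. This is
`measure_process_notMem_le`.

Hitting times are bounded by explicit superharmonic functions. Reaching the two deep traps costs
about distance times shallow depth, which is `o(l / q) = o(t)`. A return to a deep trap costs `o(l)`
plus `t / D`, where `D` of order `κ / q` is the distance to further deep traps; since `t / D` is of
order `l / κ`, this is small compared with `K * l` for large `K` (`quenched_localisation`). A union
bound shows that the required landscape is likely (`measureReal_not_good_le`). -/

lemma lintegral_stepLaw (f : ℤ → ℝ≥0∞) : ∫⁻ e, f e ∂stepLaw = (f (-1) + f 1) / 2 := by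
  rw [lintegral_countable', tsum_eq_sum (s := {-1, 1})]
  · have h : ∀ e : ℤ, stepLaw {e} = if e = -1 ∨ e = 1 then (2 : ℝ≥0∞)⁻¹ else 0 := by
      intro e
      rw [stepLaw, PMF.toMeasure_apply_singleton _ _ (measurableSet_singleton e),
        PMF.uniformOfFinset_apply]
      simp
    rw [Finset.sum_pair (by norm_num), h, h]
    simp [div_eq_mul_inv, add_mul]
  · intro e he
    have : stepLaw {e} = 0 := by
      rw [stepLaw, PMF.toMeasure_apply_singleton _ _ (measurableSet_singleton e),
        PMF.uniformOfFinset_apply, if_neg he]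
    rw [this, mul_zero]

lemma expMeasure_Ioi {v : ℝ} (hv : 0 ≤ v) :
    expMeasure 1 (Set.Ioi v) = ENNReal.ofReal (Real.exp (-v)) := by
  have h1 : Set.Ioi v = (Set.Iic v)ᶜ := by simp
  rw [h1, prob_compl_eq_one_sub measurableSet_Iic, ← ofReal_cdf, cdf_expMeasure_eq one_pos,
    if_pos hv, ← ENNReal.ofReal_one, ← ENNReal.ofReal_sub]
  · simp
  · simpa using hv

lemma lintegral_expMeasure (f : ℝ → ℝ≥0∞) (hf : Measurable f) :
    ∫⁻ v, f v ∂(expMeasure 1)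
      = ∫⁻ v, ENNReal.ofReal (if 0 ≤ v then Real.exp (-v) else 0) * f v := by
  have hm : Measurable (gammaPDF 1 1) := (measurable_gammaPDFReal 1 1).ennreal_ofReal
  rw [expMeasure, gammaMeasure, lintegral_withDensity_eq_lintegral_mul _ hm hf]
  refine lintegral_congr fun v => ?_
  have := exponentialPDF_eq 1 v
  rw [exponentialPDF, exponentialPDFReal] at this
  simp only [Pi.mul_apply, gammaPDF, this]
  simp

lemma ae_expMeasure_pos : ∀ᵐ v ∂(expMeasure 1), 0 < v := by
  have h : expMeasure 1 (Set.Ioi 0) = 1 := by simp [expMeasure_Ioi le_rfl]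
  exact (prob_compl_eq_zero_iff measurableSet_Ioi).2 h

lemma lintegral_ofReal_expMeasure : ∫⁻ v, ENNReal.ofReal v ∂(expMeasure 1) = 1 := by
  rw [lintegral_eq_lintegral_meas_lt _ (ae_expMeasure_pos.mono fun v hv => hv.le)
    (by fun_prop)]
  have h : ∀ v ∈ Set.Ioi (0 : ℝ), expMeasure 1 {a | v < a} = exponentialPDF 1 v := by
    intro v hv
    have := expMeasure_Ioi (le_of_lt hv)
    rw [exponentialPDF_of_nonneg (le_of_lt hv)]
    simpa [Set.Ioi] using this
  rw [setLIntegral_congr_fun measurableSet_Ioi h]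
  have h2 := lintegral_exponentialPDF_eq_one (r := 1) one_pos
  rw [← lintegral_add_compl _ (measurableSet_Ioi (a := (0 : ℝ))), Set.compl_Ioi] at h2
  rwa [← setLIntegral_congr Iio_ae_eq_Iic, lintegral_exponentialPDF_of_nonpos le_rfl,
    add_zero] at h2

lemma lintegral_comp_affine {S : ℝ} (hS : 0 < S) (a : ℝ) (F : ℝ → ℝ≥0∞) (hF : Measurable F) :
    ∫⁻ v, F (a + S * v) = ENNReal.ofReal (1 / S) * ∫⁻ u, F u := by
  have h1 : ∫⁻ v, F (a + S * v) = ∫⁻ u, F (a + u) ∂(Measure.map (S * ·) volume) := by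
    rw [lintegral_map (by fun_prop) (by fun_prop)]
  rw [h1, Real.map_volume_mul_left hS.ne', lintegral_smul_measure,
    lintegral_add_left_eq_self F a, abs_of_pos (inv_pos.2 hS)]
  simp

/-- The density of `a + S ξ` at `u` is the probability that `[a, a + S ξ)` covers `u`, divided by
`S`. -/
lemma lintegral_exp_affine {S : ℝ} (hS : 0 < S) (a : ℝ) (g : ℝ → ℝ≥0∞) (hg : Measurable g) :
    ∫⁻ v, g (a + S * v) ∂(expMeasure 1)
      = ENNReal.ofReal (1 / S) *
        ∫⁻ u, g u * expMeasure 1 {v | a ≤ u ∧ u < a + S * v} := by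
  set F : ℝ → ℝ≥0∞ := fun u =>
    g u * ENNReal.ofReal (if a ≤ u then Real.exp (-((u - a) / S)) else 0) with hFdef
  have hm : Measurable fun u : ℝ => if a ≤ u then Real.exp (-((u - a) / S)) else 0 :=
    Measurable.ite measurableSet_Ici (by fun_prop) (by fun_prop)
  have hF : Measurable F := hg.mul hm.ennreal_ofReal
  have h2 : ∀ u, g u * expMeasure 1 {v | a ≤ u ∧ u < a + S * v} = F u := by
    intro u
    by_cases hu : a ≤ u
    · have : {v | a ≤ u ∧ u < a + S * v} = Set.Ioi ((u - a) / S) := by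
        ext v
        simp only [hu, true_and, Set.mem_ofPred_eq, Set.mem_Ioi, div_lt_iff₀ hS]
        constructor <;> intro h <;> linarith
      rw [this, expMeasure_Ioi (div_nonneg (by linarith) hS.le)]
      simp [hFdef, hu]
    · simp [hFdef, hu]
  simp_rw [h2]
  rw [← lintegral_comp_affine hS a F hF, lintegral_expMeasure _ (by fun_prop)]
  refine lintegral_congr fun v => ?_
  have h3 : a ≤ a + S * v ↔ 0 ≤ v := by
    constructor
    · intro h; by_contra hv; push Not at hv; nlinarith
    · intro h; nlinarith
  simp only [hFdef, h3]
  rw [mul_comm]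
  congr 3
  have : (a + S * v - a) / S = v := by field_simp; ring
  rw [this]

/-! ### Splicing the noise -/

abbrev Noise := ℕ → ℤ × ℝ

/-- The first `k` entries of `p.1` followed by `p.2`. -/
def splice (k : ℕ) (p : Noise × Noise) : Noise := fun n => if n < k then p.1 n else p.2 (n - k)

def shift (k : ℕ) (w : Noise) : Noise := fun n => w (k + n)

@[fun_prop]
lemma measurable_splice (k : ℕ) : Measurable (splice k) := by
  refine measurable_pi_lambda _ fun n => ?_
  unfold splice
  split_ifs <;> fun_prop

@[fun_prop]
lemma measurable_shift (k : ℕ) : Measurable (shift k) := by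
  unfold shift; fun_prop

/-- This plays the role of the Markov property at the fixed step `k`: the noise from step `k` on may
be resampled independently of the past. It is enough to compare the two laws on finite boxes, whose
coordinates split at `k`. -/
lemma measurePreserving_splice (k : ℕ) :
    MeasurePreserving (splice k) (noiseLaw.prod noiseLaw) noiseLaw := by
  refine ⟨measurable_splice k, ?_⟩
  rw [noiseLaw]
  refine Measure.eq_infinitePi _ fun s t ht => ?_
  rw [Measure.map_apply (measurable_splice k) (MeasurableSet.pi s.countable_toSet fun i _ => ht i)]
  classical
  set s1 := s.filter (· < k)
  set s2 := (s.filter (fun n => ¬ n < k))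
  have hpre : splice k ⁻¹' (Set.pi s t)
      = (Set.pi s1 t) ×ˢ (Set.pi (s2.image (· - k)) (fun n => t (n + k))) := by
    ext ⟨w, w'⟩
    simp only [Set.mem_preimage, Set.mem_pi, Set.mem_prod, splice, s1, s2, Finset.coe_filter,
      Finset.coe_image, Set.mem_image, Set.mem_ofPred_eq, Finset.mem_coe]
    constructor
    · intro h
      refine ⟨fun n hn => ?_, ?_⟩
      · have := h n hn.1
        rwa [if_pos hn.2] at this
      · rintro _ ⟨n, hn, rfl⟩
        have := h n hn.1
        rw [if_neg hn.2] at this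
        rwa [Nat.sub_add_cancel (not_lt.1 hn.2)]
    · rintro ⟨h1, h2⟩ n hn
      by_cases hk : n < k
      · rw [if_pos hk]; exact h1 n ⟨hn, hk⟩
      · rw [if_neg hk]
        have := h2 (n - k) ⟨n, ⟨hn, hk⟩, rfl⟩
        rwa [Nat.sub_add_cancel (not_lt.1 hk)] at this
  rw [hpre, Measure.prod_prod, Measure.infinitePi_pi _ (fun i _ => ht i),
    Measure.infinitePi_pi _ (fun i _ => ht _), ← Finset.prod_filter_mul_prod_filter_not s (· < k)]
  congr 1
  rw [Finset.prod_image]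
  · refine Finset.prod_congr rfl fun n hn => ?_
    have : k ≤ n := not_lt.1 (Finset.mem_filter.1 hn).2
    rw [Nat.sub_add_cancel this]
  · intro a ha b hb hab
    have h1 : k ≤ a := not_lt.1 (Finset.mem_filter.1 ha).2
    have h2 : k ≤ b := not_lt.1 (Finset.mem_filter.1 hb).2
    simp only at hab
    omega

lemma lintegral_splice (k : ℕ) (F : Noise → ℝ≥0∞) (hF : Measurable F) :
    ∫⁻ w, F w ∂noiseLaw = ∫⁻ w, ∫⁻ w', F (splice k (w, w')) ∂noiseLaw ∂noiseLaw := by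
  rw [← (measurePreserving_splice k).lintegral_comp hF, lintegral_prod]
  exact (hF.comp (measurable_splice k)).aemeasurable

lemma lintegral_eval (n : ℕ) (f : ℤ × ℝ → ℝ≥0∞) (hf : Measurable f) :
    ∫⁻ w, f (w n) ∂noiseLaw = ∫⁻ v, ∫⁻ e, f (e, v) ∂stepLaw ∂(expMeasure 1) := by
  have h := (measurePreserving_eval_infinitePi (fun _ : ℕ => stepLaw.prod (expMeasure 1)) n)
  have h2 := h.lintegral_comp hf
  rw [noiseLaw]
  simp only [Function.eval] at h2
  rw [h2, lintegral_prod_symm _ hf.aemeasurable]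

/-- First-step decomposition of the noise. -/
lemma lintegral_first_step (F : ℤ × ℝ → Noise → ℝ≥0∞) (hF : Measurable (Function.uncurry F)) :
    ∫⁻ w, F (w 0) (shift 1 w) ∂noiseLaw
      = ∫⁻ v, ∫⁻ e, ∫⁻ w, F (e, v) w ∂noiseLaw ∂stepLaw ∂(expMeasure 1) := by
  have hm : Measurable fun w : Noise => F (w 0) (shift 1 w) :=
    hF.comp (f := fun w : Noise => (w 0, shift 1 w)) (by fun_prop)
  rw [lintegral_splice 1 _ hm]
  have h0 : ∀ w w' : Noise, splice 1 (w, w') 0 = w 0 := fun w w' => by simp [splice]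
  have h1 : ∀ w w' : Noise, shift 1 (splice 1 (w, w')) = w' := fun w w' => by
    funext n; simp [splice, shift]
  simp_rw [h0, h1]
  exact lintegral_eval 0 (fun p => ∫⁻ w', F p w' ∂noiseLaw) hF.lintegral_prod_right'

lemma ae_noise_pos : ∀ᵐ w ∂noiseLaw, ∀ n, 0 < (w n).2 := by
  rw [ae_all_iff]
  intro n
  have h := (measurePreserving_eval_infinitePi (fun _ : ℕ => stepLaw.prod (expMeasure 1)) n)
  have h2 : ∀ᵐ p ∂(stepLaw.prod (expMeasure 1)), 0 < p.2 :=
    Measure.quasiMeasurePreserving_snd.ae ae_expMeasure_pos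
  exact h.quasiMeasurePreserving.ae h2

end

section

open scoped ENNReal

/-! ### The cost of the walk until it enters a target set -/

open Classical in
/-- The time, increased by `η` at every step, which the walk from `x` spends in its first `N` steps
before it enters `G`. -/
def killedCost (s : ℤ → ℝ) (η : ℝ) (G : Set ℤ) : ℕ → ℤ → Noise → ℝ≥0∞
  | 0, _, _ => 0
  | N + 1, x, w => if x ∈ G then 0 else
      ENNReal.ofReal (s x * (w 0).2 + η) + killedCost s η G N (x + (w 0).1) (shift 1 w)

/-- The time, increased by `η` at every step, before the walk from `x` enters `G`. -/
def hitCost (s : ℤ → ℝ) (η : ℝ) (G : Set ℤ) (x : ℤ) (w : Noise) : ℝ≥0∞ :=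
  ⨆ N, killedCost s η G N x w

variable {s : ℤ → ℝ} {η : ℝ} {G : Set ℤ}

lemma measurable_uncurry_killedCost (N : ℕ) :
    Measurable fun p : ℤ × Noise => killedCost s η G N p.1 p.2 := by
  induction N with
  | zero => exact measurable_const
  | succ N ih =>
    refine measurable_from_prod_countable_right fun x => ?_
    simp only [killedCost]
    split_ifs
    · exact measurable_const
    · have h2 : Measurable fun w : Noise => killedCost s η G N (x + (w 0).1) (shift 1 w) :=
        ih.comp (f := fun w : Noise => (x + (w 0).1, shift 1 w)) (by fun_prop)
      exact (by fun_prop : Measurable fun w : Noise => ENNReal.ofReal (s x * (w 0).2 + η)).add h2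

lemma measurable_uncurry_hitCost :
    Measurable fun p : ℤ × Noise => hitCost s η G p.1 p.2 :=
  Measurable.iSup fun N => measurable_uncurry_killedCost N

lemma measurable_killedCost (N : ℕ) (x : ℤ) : Measurable (killedCost s η G N x) :=
  (measurable_uncurry_killedCost N).comp measurable_prodMk_left

lemma measurable_hitCost (x : ℤ) : Measurable (hitCost s η G x) :=
  measurable_uncurry_hitCost.comp measurable_prodMk_left

lemma killedCost_le_succ (N : ℕ) (x : ℤ) (w : Noise) :
    killedCost s η G N x w ≤ killedCost s η G (N + 1) x w := by
  induction N generalizing x w with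
  | zero => exact zero_le
  | succ N ih =>
    rw [killedCost, killedCost]
    split_ifs
    · exact le_rfl
    · exact add_le_add le_rfl (ih _ _)

/-- Induction on the number of steps, conditioning on the first one. Superharmonicity is only asked
up to the cap `t`, because the left side never exceeds `t`. -/
lemma lintegral_min_killedCost_le (hs : ∀ x, 0 < s x) (hη : 0 ≤ η) {t : ℝ} {h : ℤ → ℝ}
    (hh : ∀ x, 0 ≤ h x)
    (hsuper : ∀ x, x ∉ G → min t (s x + η + (h (x - 1) + h (x + 1)) / 2) ≤ h x) (N : ℕ) (x : ℤ) :
    ∫⁻ w, min (ENNReal.ofReal t) (killedCost s η G N x w) ∂noiseLaw ≤ ENNReal.ofReal (h x) := by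
  induction N generalizing x with
  | zero => simp [killedCost]
  | succ N ih =>
    by_cases hx : x ∈ G
    · simp [killedCost, hx]
    have hle : ENNReal.ofReal (min t (s x + η + (h (x - 1) + h (x + 1)) / 2))
        ≤ ENNReal.ofReal (h x) := ENNReal.ofReal_le_ofReal (hsuper x hx)
    refine le_trans ?_ hle
    rw [ENNReal.ofReal_min]
    refine le_min ?_ ?_
    · calc _ ≤ ∫⁻ _, ENNReal.ofReal t ∂noiseLaw := lintegral_mono fun w => min_le_left _ _
        _ = _ := by simp
    simp only [killedCost, hx, if_false]
    have hm0 : Measurable fun p : (ℤ × ℝ) × Noise => killedCost s η G N (x + p.1.1) p.2 :=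
      (measurable_uncurry_killedCost N).comp
        (f := fun p : (ℤ × ℝ) × Noise => (x + p.1.1, p.2)) (by fun_prop)
    have hm : Measurable (Function.uncurry fun (p : ℤ × ℝ) (w : Noise) =>
        min (ENNReal.ofReal t)
          (ENNReal.ofReal (s x * p.2 + η) + killedCost s η G N (x + p.1) w)) :=
      measurable_const.min ((by fun_prop : Measurable fun p : (ℤ × ℝ) × Noise =>
        ENNReal.ofReal (s x * p.1.2 + η)).add hm0)
    rw [lintegral_first_step _ hm]
    have hinner : ∀ v : ℝ, ∀ e : ℤ, ∫⁻ w, min (ENNReal.ofReal t)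
          (ENNReal.ofReal (s x * v + η) + killedCost s η G N (x + e) w) ∂noiseLaw
        ≤ ENNReal.ofReal (s x * v + η) + ENNReal.ofReal (h (x + e)) := by
      intro v e
      calc _ ≤ ∫⁻ w, (ENNReal.ofReal (s x * v + η) +
              min (ENNReal.ofReal t) (killedCost s η G N (x + e) w)) ∂noiseLaw := by
            refine lintegral_mono fun w => ?_
            -- With `c` the cost of the first step and `k` the later cost, `min t (c + k) ≤ c + min
            -- t k`.
            rw [← min_add_add_left]
            exact min_le_min le_add_self le_rfl
        _ ≤ _ := by
            rw [lintegral_add_left measurable_const]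
            simp only [lintegral_const, measure_univ, mul_one]
            exact add_le_add le_rfl (ih _)
    calc _ ≤ ∫⁻ v, ∫⁻ e, (ENNReal.ofReal (s x * v + η) + ENNReal.ofReal (h (x + e)))
              ∂stepLaw ∂(expMeasure 1) :=
          lintegral_mono fun v => lintegral_mono fun e => hinner v e
      _ = ∫⁻ v, (ENNReal.ofReal (s x * v + η)
            + ENNReal.ofReal ((h (x - 1) + h (x + 1)) / 2)) ∂(expMeasure 1) := by
          refine lintegral_congr fun v => ?_
          rw [lintegral_add_left measurable_const, lintegral_const, measure_univ, mul_one,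
            lintegral_stepLaw]
          rw [ENNReal.ofReal_div_of_pos two_pos, ENNReal.ofReal_add (hh _) (hh _)]
          simp [sub_eq_add_neg]
      _ ≤ ∫⁻ v, ((ENNReal.ofReal (s x) * ENNReal.ofReal v + ENNReal.ofReal η)
            + ENNReal.ofReal ((h (x - 1) + h (x + 1)) / 2)) ∂(expMeasure 1) := by
          refine lintegral_mono fun v => add_le_add ?_ le_rfl
          rw [← ENNReal.ofReal_mul (hs x).le]
          exact ENNReal.ofReal_add_le
      _ = _ := by
          rw [lintegral_add_right _ measurable_const, lintegral_add_right _ measurable_const,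
            lintegral_const_mul _ (by fun_prop), lintegral_ofReal_expMeasure]
          simp only [lintegral_const, measure_univ, mul_one]
          rw [ENNReal.ofReal_add (add_nonneg (hs x).le hη)
            (by have := hh (x - 1); have := hh (x + 1); positivity),
            ENNReal.ofReal_add (hs x).le hη]

/-- A function which is superharmonic with respect to the cost dominates the mean truncated
hitting time. -/
lemma lintegral_min_hitCost_le (hs : ∀ x, 0 < s x) (hη : 0 ≤ η) {t : ℝ} {h : ℤ → ℝ}
    (hh : ∀ x, 0 ≤ h x)
    (hsuper : ∀ x, x ∉ G → min t (s x + η + (h (x - 1) + h (x + 1)) / 2) ≤ h x) (x : ℤ) :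
    ∫⁻ w, min (ENNReal.ofReal t) (hitCost s η G x w) ∂noiseLaw ≤ ENNReal.ofReal (h x) := by
  have h1 : ∀ w, min (ENNReal.ofReal t) (hitCost s η G x w)
      = ⨆ N, min (ENNReal.ofReal t) (killedCost s η G N x w) := fun w => by
    rw [hitCost]; exact inf_iSup_eq _ _
  simp_rw [h1]
  rw [lintegral_iSup (fun N => measurable_const.min (measurable_killedCost N x))]
  · exact iSup_le fun N => lintegral_min_killedCost_le hs hη hh hsuper N x
  · exact monotone_nat_of_le_succ fun N w => min_le_min le_rfl (killedCost_le_succ N x w)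

/-- The cost of a path which avoids `G` is the total time spent, plus `η` for each step. -/
lemma le_killedCost {w : Noise} (hs : ∀ x, 0 < s x) (hη : 0 ≤ η) (hw : ∀ n, 0 < (w n).2)
    {x : ℤ} {N : ℕ} (hN : ∀ j < N, x + walk w j ∉ G) :
    ENNReal.ofReal (∑ j ∈ Finset.range N, s (x + walk w j) * (w j).2 + N * η)
      ≤ killedCost s η G N x w := by
  induction N generalizing x w with
  | zero => simp [killedCost]
  | succ N ih =>
    have hx : x ∉ G := by simpa [walk] using hN 0 (Nat.succ_pos _)
    have hwalk : ∀ j, x + (w 0).1 + walk (shift 1 w) j = x + walk w (j + 1) := fun j => by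
      simp only [walk, shift, Finset.sum_range_succ' _ j, add_comm 1]
      ring
    rw [killedCost, if_neg hx]
    have h2 := ih (w := shift 1 w) (x := x + (w 0).1) (fun n => hw _)
      (fun j hj => by rw [hwalk]; exact hN _ (by omega))
    refine le_trans (le_of_eq ?_) (add_le_add le_rfl h2)
    rw [← ENNReal.ofReal_add]
    · congr 1
      rw [Finset.sum_range_succ']
      simp only [hwalk]
      simp only [shift, walk, Finset.sum_range_zero, add_zero, add_comm 1]
      push_cast
      ring
    · exact add_nonneg (mul_nonneg (hs x).le (hw 0).le) hη
    · exact add_nonneg (Finset.sum_nonneg fun j _ => mul_nonneg (hs _).le (hw _).le)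
        (mul_nonneg (Nat.cast_nonneg _) hη)

end

section

open scoped ENNReal

/-! ### A Campbell formula for the end points of the visits to a site -/

@[fun_prop]
lemma measurable_walk (k : ℕ) : Measurable fun w : Noise => walk w k := by
  unfold walk; fun_prop

@[fun_prop]
lemma measurable_jumpTime (s : ℤ → ℝ) (k : ℕ) : Measurable fun w : Noise => jumpTime s w k := by
  unfold jumpTime
  have hs : Measurable s := Measurable.of_discrete
  exact Finset.measurable_sum _ fun i _ =>
    (hs.comp (measurable_walk i)).mul (by fun_prop)

lemma walk_splice (k : ℕ) (w w' : Noise) {j : ℕ} (hj : j ≤ k) :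
    walk (splice k (w, w')) j = walk w j :=
  Finset.sum_congr rfl fun i hi => by
    simp [splice, lt_of_lt_of_le (Finset.mem_range.1 hi) hj]

lemma jumpTime_splice (s : ℤ → ℝ) (k : ℕ) (w w' : Noise) :
    jumpTime s (splice k (w, w')) k = jumpTime s w k :=
  Finset.sum_congr rfl fun i hi => by
    have h := Finset.mem_range.1 hi
    rw [walk_splice k w w' h.le]
    simp [splice, h]

lemma jumpTime_succ (s : ℤ → ℝ) (w : Noise) (k : ℕ) :
    jumpTime s w (k + 1) = jumpTime s w k + s (walk w k) * (w k).2 :=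
  Finset.sum_range_succ _ _

lemma jumpTime_splice_succ (s : ℤ → ℝ) (k : ℕ) (w w' : Noise) :
    jumpTime s (splice k (w, w')) (k + 1) = jumpTime s w k + s (walk w k) * (w' 0).2 := by
  rw [jumpTime_succ, jumpTime_splice, walk_splice k w w' le_rfl]
  simp [splice]

lemma jumpTime_mono {s : ℤ → ℝ} {w : Noise} (hs : ∀ x, 0 < s x) (hw : ∀ n, 0 < (w n).2) :
    Monotone (jumpTime s w) :=
  monotone_nat_of_le_succ fun k => by
    rw [jumpTime_succ]
    exact le_add_of_nonneg_right (mul_nonneg (hs _).le (hw _).le)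

variable {s : ℤ → ℝ}

lemma measure_holding (z : ℤ) (k : ℕ) (u : ℝ) :
    noiseLaw {w | walk w k = z ∧ jumpTime s w k ≤ u ∧ u < jumpTime s w (k + 1)}
      = ∫⁻ w, (if walk w k = z then
          expMeasure 1 {v | jumpTime s w k ≤ u ∧ u < jumpTime s w k + s z * v} else 0)
          ∂noiseLaw := by
  have hS : MeasurableSet
      {w : Noise | walk w k = z ∧ jumpTime s w k ≤ u ∧ u < jumpTime s w (k + 1)} :=
    (measurableSet_eq_fun (measurable_walk k) measurable_const).inter
      ((measurableSet_le (measurable_jumpTime s k) measurable_const).inter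
        (measurableSet_lt measurable_const (measurable_jumpTime s (k + 1))))
  rw [← lintegral_indicator_one hS, lintegral_splice k _ (measurable_one.indicator hS)]
  refine lintegral_congr fun w => ?_
  have h0 : ∀ w', Set.indicator
      {w : Noise | walk w k = z ∧ jumpTime s w k ≤ u ∧ u < jumpTime s w (k + 1)} 1
        (splice k (w, w'))
      = (fun p : ℤ × ℝ => if walk w k = z then Set.indicator
          {v : ℝ | jumpTime s w k ≤ u ∧ u < jumpTime s w k + s z * v} (1 : ℝ → ℝ≥0∞) p.2 else 0)
          (w' 0) := by
    intro w'
    simp only [Set.indicator, Set.mem_ofPred_eq, walk_splice k w w' le_rfl, jumpTime_splice,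
      jumpTime_splice_succ]
    by_cases hz : walk w k = z
    · simp [hz]
    · simp [hz]
  have hE : MeasurableSet {v : ℝ | jumpTime s w k ≤ u ∧ u < jumpTime s w k + s z * v} :=
    (MeasurableSet.const _).inter (measurableSet_lt measurable_const
      (measurable_const.add (measurable_id.const_mul _)))
  simp_rw [h0]
  by_cases hz : walk w k = z
  · simp only [hz, if_true]
    rw [lintegral_eval 0 (fun p => Set.indicator
      {v : ℝ | jumpTime s w k ≤ u ∧ u < jumpTime s w k + s z * v} (1 : ℝ → ℝ≥0∞) p.2)
      ((measurable_one.indicator hE).comp measurable_snd)]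
    simp only [lintegral_const, measure_univ, mul_one]
    rw [lintegral_indicator_one hE]
  · simp [hz]

/-- The holding intervals `[T_k, T_{k+1})` are almost surely disjoint, so at most one visit is in
progress at time `u` and the probabilities add up to that of a single event. -/
lemma tsum_measure_holding_le (hs : ∀ x, 0 < s x) (z : ℤ) (u : ℝ) :
    ∑' k, noiseLaw {w | walk w k = z ∧ jumpTime s w k ≤ u ∧ u < jumpTime s w (k + 1)} ≤ 1 := by
  set A : ℕ → Set Noise := fun k =>
    {w | walk w k = z ∧ jumpTime s w k ≤ u ∧ u < jumpTime s w (k + 1)}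
  have hA : ∀ k, MeasurableSet (A k) := fun k =>
    (measurableSet_eq_fun (measurable_walk k) measurable_const).inter
      ((measurableSet_le (measurable_jumpTime s k) measurable_const).inter
        (measurableSet_lt measurable_const (measurable_jumpTime s (k + 1))))
  have hd : Pairwise (Function.onFun (AEDisjoint noiseLaw) A) := by
    intro i j hij
    refine measure_mono_null ?_ ae_noise_pos
    rintro w ⟨⟨-, hi⟩, ⟨-, hj⟩⟩ hw
    have := (jumpTime_mono hs hw).pairwise_disjoint_on_Ico_succ hij
    exact Set.disjoint_left.1 this ⟨hi.1, hi.2⟩ ⟨hj.1, hj.2⟩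
  rw [← measure_iUnion₀ hd fun k => (hA k).nullMeasurableSet]
  exact prob_le_one

/-- Given the first `k` entries of the noise and `walk w k = z`, the visit ends at `a + s z * ξ`
with `ξ` a fresh exponential. By `lintegral_exp_affine` its density at `u` is `1 / s z` times the
probability that the visit is in progress at `u`. The next step and the later noise are independent
of all this, so the mark integrates out separately. -/
lemma lintegral_visit_end (hs : ∀ x, 0 < s x) (z : ℤ) (k : ℕ) {g : ℝ → ℤ × Noise → ℝ≥0∞}
    (hg : Measurable (Function.uncurry g)) :
    ∫⁻ w, (if walk w k = z then g (jumpTime s w (k + 1)) ((w k).1, shift (k + 1) w) else 0)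
        ∂noiseLaw
      = ENNReal.ofReal (1 / s z) * ∫⁻ u, (∫⁻ p, g u p ∂(stepLaw.prod noiseLaw)) *
          noiseLaw {w | walk w k = z ∧ jumpTime s w k ≤ u ∧ u < jumpTime s w (k + 1)} := by
  set ψ : ℝ → ℝ≥0∞ := fun u => ∫⁻ p, g u p ∂(stepLaw.prod noiseLaw) with hψdef
  have hψ : Measurable ψ := hg.lintegral_prod_right'
  have hgw : Measurable fun w : Noise =>
      g (jumpTime s w (k + 1)) ((w k).1, shift (k + 1) w) :=
    hg.comp (f := fun w : Noise => (jumpTime s w (k + 1), ((w k).1, shift (k + 1) w)))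
      (by fun_prop)
  have hz : MeasurableSet {w : Noise | walk w k = z} :=
    measurableSet_eq_fun (measurable_walk k) measurable_const
  have hstep : ∀ w : Noise, ∫⁻ w', g (jumpTime s w k + s z * (w' 0).2) ((w' 0).1, shift 1 w')
      ∂noiseLaw = ∫⁻ v, ψ (jumpTime s w k + s z * v) ∂(expMeasure 1) := by
    intro w
    have hm : Measurable (Function.uncurry fun (p : ℤ × ℝ) (w' : Noise) =>
        g (jumpTime s w k + s z * p.2) (p.1, w')) :=
      hg.comp (f := fun q : (ℤ × ℝ) × Noise => (jumpTime s w k + s z * q.1.2, (q.1.1, q.2)))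
        (by fun_prop)
    rw [lintegral_first_step _ hm]
    refine lintegral_congr fun v => ?_
    rw [hψdef]
    simp only
    rw [lintegral_prod]
    exact (hg.comp measurable_prodMk_left).aemeasurable
  rw [lintegral_splice k _ (Measurable.ite hz hgw measurable_const)]
  have h1 : ∀ w : Noise, ∫⁻ w', (if walk (splice k (w, w')) k = z then
        g (jumpTime s (splice k (w, w')) (k + 1))
          ((splice k (w, w') k).1, shift (k + 1) (splice k (w, w'))) else 0) ∂noiseLaw
      = ENNReal.ofReal (1 / s z) * ∫⁻ u, ψ u * (if walk w k = z then
          expMeasure 1 {v | jumpTime s w k ≤ u ∧ u < jumpTime s w k + s z * v} else 0) := by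
    intro w
    by_cases hw : walk w k = z
    · have hsh : ∀ w' : Noise, shift (k + 1) (splice k (w, w')) = shift 1 w' := fun w' => by
        funext n
        simp only [shift, splice]
        rw [if_neg (by omega)]
        congr 1
        omega
      have hk : ∀ w' : Noise, splice k (w, w') k = w' 0 := fun w' => by simp [splice]
      simp only [walk_splice k w _ le_rfl, hw, if_true, jumpTime_splice_succ, hsh, hk]
      rw [hstep, lintegral_exp_affine (hs z) _ _ hψ]
    · simp [walk_splice k w _ le_rfl, hw]
  simp_rw [h1]
  have hset : Measurable fun p : Noise × ℝ => (if walk p.1 k = z then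
      expMeasure 1 {v | jumpTime s p.1 k ≤ p.2 ∧ p.2 < jumpTime s p.1 k + s z * v} else 0) := by
    refine Measurable.ite (measurableSet_eq_fun ((measurable_walk k).comp measurable_fst)
      measurable_const) ?_ measurable_const
    have hT : Measurable fun q : (Noise × ℝ) × ℝ => jumpTime s q.1.1 k :=
      (measurable_jumpTime s k).comp (measurable_fst.comp measurable_fst)
    have hM : MeasurableSet {q : (Noise × ℝ) × ℝ |
        jumpTime s q.1.1 k ≤ q.1.2 ∧ q.1.2 < jumpTime s q.1.1 k + s z * q.2} :=
      (measurableSet_le hT (by fun_prop)).inter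
        (measurableSet_lt (by fun_prop) (hT.add (by fun_prop)))
    exact measurable_measure_prodMk_left hM
  have hfull : Measurable fun p : Noise × ℝ => ψ p.2 * (if walk p.1 k = z then
      expMeasure 1 {v | jumpTime s p.1 k ≤ p.2 ∧ p.2 < jumpTime s p.1 k + s z * v} else 0) :=
    (hψ.comp measurable_snd).mul hset
  rw [lintegral_const_mul _ hfull.lintegral_prod_right', lintegral_lintegral_swap
    hfull.aemeasurable]
  congr 1
  refine lintegral_congr fun u => ?_
  rw [measure_holding]
  simp only
  rw [lintegral_const_mul]
  exact hset.comp measurable_prodMk_right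

/-- The point process of the end points of the visits to `z`, marked with the subsequent noise, has
intensity at most `1 / s z`. -/
lemma tsum_lintegral_visit_end_le (hs : ∀ x, 0 < s x) (z : ℤ) {g : ℝ → ℤ × Noise → ℝ≥0∞}
    (hg : Measurable (Function.uncurry g)) :
    ∑' k, ∫⁻ w, (if walk w k = z then g (jumpTime s w (k + 1)) ((w k).1, shift (k + 1) w) else 0)
        ∂noiseLaw
      ≤ ENNReal.ofReal (1 / s z) * ∫⁻ u, ∫⁻ p, g u p ∂(stepLaw.prod noiseLaw) := by
  have hψ : Measurable fun u => ∫⁻ p, g u p ∂(stepLaw.prod noiseLaw) := hg.lintegral_prod_right'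
  have hq : ∀ k, Measurable fun u : ℝ =>
      noiseLaw {w | walk w k = z ∧ jumpTime s w k ≤ u ∧ u < jumpTime s w (k + 1)} := by
    intro k
    have hM : MeasurableSet {q : ℝ × Noise |
        walk q.2 k = z ∧ jumpTime s q.2 k ≤ q.1 ∧ q.1 < jumpTime s q.2 (k + 1)} :=
      (measurableSet_eq_fun ((measurable_walk k).comp measurable_snd) measurable_const).inter
        ((measurableSet_le ((measurable_jumpTime s k).comp measurable_snd) measurable_fst).inter
        (measurableSet_lt measurable_fst ((measurable_jumpTime s (k + 1)).comp measurable_snd)))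
    exact measurable_measure_prodMk_left hM
  simp_rw [lintegral_visit_end hs z _ hg]
  rw [ENNReal.tsum_mul_left, ← lintegral_tsum fun k => (hψ.fun_mul (hq k)).aemeasurable]
  gcongr with u
  rw [ENNReal.tsum_mul_left]
  exact mul_le_of_le_one_right' (tsum_measure_holding_le hs z u)

end

section

open scoped ENNReal

/-! ### The quenched estimate -/

lemma walk_shift (w : Noise) (m j : ℕ) : walk w m + walk (shift m w) j = walk w (m + j) := by
  simp only [walk, shift, Finset.sum_range_add]

lemma jumpTime_shift (s : ℤ → ℝ) (w : Noise) (m N : ℕ) :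
    ∑ j ∈ Finset.range N, s (walk w m + walk (shift m w) j) * (shift m w j).2
      = jumpTime s w (m + N) - jumpTime s w m := by
  simp only [walk_shift, jumpTime, Finset.sum_range_add, shift]
  ring

/-- The index `m` is one past the last `k < n` satisfying `p`, or `0` if there is none. -/
lemma exists_last_visit (p : ℕ → Prop) (n : ℕ) :
    ∃ m ≤ n, (m = 0 ∨ ∃ k, m = k + 1 ∧ p k) ∧ ∀ j, m ≤ j → j < n → ¬ p j := by
  induction n with
  | zero => exact ⟨0, le_rfl, Or.inl rfl, fun j _ h => absurd h (Nat.not_lt_zero j)⟩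
  | succ n ih =>
    by_cases hp : p n
    · exact ⟨n + 1, le_rfl, Or.inr ⟨n, rfl, hp⟩, fun j h1 h2 => by omega⟩
    · obtain ⟨m, hm, h0, h1⟩ := ih
      refine ⟨m, by omega, h0, fun j hj hj2 => ?_⟩
      rcases Nat.lt_succ_iff_lt_or_eq.1 hj2 with h | rfl
      · exact h1 j hj h
      · exact hp

variable {s : ℤ → ℝ} {η : ℝ}

lemma le_hitCost_shift {G : Set ℤ} {w : Noise} (hs : ∀ x, 0 < s x) (hη : 0 ≤ η)
    (hw : ∀ n, 0 < (w n).2) {m N : ℕ} (hN : ∀ j, m ≤ j → j < m + N → walk w j ∉ G) :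
    ENNReal.ofReal (jumpTime s w (m + N) - jumpTime s w m + N * η)
      ≤ hitCost s η G (walk w m) (shift m w) := by
  rw [← jumpTime_shift]
  refine le_trans (le_killedCost (w := shift m w) hs hη (fun n => hw _) fun j hj => ?_)
    (le_iSup (fun N => killedCost s η G N (walk w m) (shift m w)) N)
  rw [walk_shift]
  exact hN _ (by omega) (by omega)

/-- The noises for which the process is, at time `t`, away from `G` after the visit to `z` of its
`k`-th step. -/
def awayAfter (s : ℤ → ℝ) (η t : ℝ) (G : Set ℤ) (z : ℤ) (k : ℕ) : Set Noise :=
  {w | walk w k = z ∧ (0 ≤ jumpTime s w (k + 1) ∧ jumpTime s w (k + 1) ≤ t) ∧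
    ENNReal.ofReal (t - jumpTime s w (k + 1)) ≤ hitCost s η G (z + (w k).1) (shift (k + 1) w)}

lemma walk_succ (w : Noise) (k : ℕ) : walk w (k + 1) = walk w k + (w k).1 :=
  Finset.sum_range_succ _ _

/-- The path is cut just after its last visit to `G`; from there it avoids `G` for at least the
remaining time. The surcharge `η` per step makes this work without proving that the jump times are
unbounded. -/
lemma away_cases {G : Finset ℤ} {w : Noise} {t : ℝ} (hs : ∀ x, 0 < s x) (hη : 0 < η)
    (hw : ∀ n, 0 < (w n).2)
    (hfin : ∀ z, ∀ᶠ k in atTop, ¬ (walk w k = z ∧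
      0 ≤ jumpTime s w (k + 1) ∧ jumpTime s w (k + 1) ≤ t))
    (hX : process s w t ∉ G) :
    ENNReal.ofReal t ≤ hitCost s η G 0 w ∨ ∃ z ∈ G, ∃ k, w ∈ awayAfter s η t G z k := by
  have hmono := jumpTime_mono hs hw
  have hT0 : jumpTime s w 0 = 0 := by simp [jumpTime]
  have hpos : ∀ n, 0 ≤ jumpTime s w n := fun n => hT0 ▸ hmono (Nat.zero_le n)
  suffices h : ∃ m, (m = 0 ∨ ∃ k, m = k + 1 ∧ walk w k ∈ G) ∧ (m ≠ 0 → jumpTime s w m ≤ t) ∧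
      ENNReal.ofReal (t - jumpTime s w m) ≤ hitCost s η G (walk w m) (shift m w) by
    obtain ⟨m, rfl | ⟨k, rfl, hk⟩, hm, hle⟩ := h
    · left
      have h0 : shift 0 w = w := by funext n; simp [shift]
      simpa [hT0, h0, walk] using hle
    · right
      refine ⟨walk w k, hk, k, rfl, ⟨hpos _, hm (Nat.succ_ne_zero k)⟩, ?_⟩
      rwa [walk_succ] at hle
  by_cases hA : {n : ℕ | t < jumpTime s w (n + 1)}.Nonempty
  · set n := sInf {n : ℕ | t < jumpTime s w (n + 1)} with hn
    have hnA : t < jumpTime s w (n + 1) := Nat.sInf_mem hA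
    have hXn : walk w n ∉ G := hX
    -- Searching below `n + 1` includes the current site `walk w n`; as it lies outside `G`, the cut
    -- satisfies `m ≤ n`.
    obtain ⟨m, hmn, h0, h1⟩ := exists_last_visit (fun k => walk w k ∈ G) (n + 1)
    have hmn' : m ≤ n := by
      rcases Nat.lt_or_ge n m with h | h
      · rcases h0 with rfl | ⟨k, rfl, hk⟩
        · omega
        · have : k = n := by omega
          exact absurd (this ▸ hk) hXn
      · exact h
    refine ⟨m, h0, fun hm0 => ?_, ?_⟩
    · refine le_trans (hmono hmn') ?_
      have hlt : n - 1 < sInf {n : ℕ | t < jumpTime s w (n + 1)} := by omega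
      have := Nat.notMem_of_lt_sInf hlt
      simp only [Set.mem_ofPred_eq, not_lt] at this
      rwa [Nat.sub_add_cancel (by omega)] at this
    · refine le_trans (ENNReal.ofReal_le_ofReal ?_)
        (le_hitCost_shift (G := (G : Set ℤ)) (N := n + 1 - m) hs hη.le hw
          fun j hj hj2 => h1 j hj (by omega))
      rw [show m + (n + 1 - m) = n + 1 by omega]
      have : (0 : ℝ) ≤ ((n + 1 - m : ℕ) : ℝ) * η := by positivity
      linarith
  -- Here the jump times never pass `t`. Since each site of `G` has finitely many visits ending by
  -- `t`, the walk leaves `G` for good.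
  · have hA' : ∀ n, jumpTime s w (n + 1) ≤ t := fun n => by
      by_contra h
      exact hA ⟨n, not_le.1 h⟩
    have hev : ∀ᶠ k in atTop, walk w k ∉ G := by
      have : ∀ᶠ k in atTop, ∀ z ∈ G, ¬ (walk w k = z ∧
          0 ≤ jumpTime s w (k + 1) ∧ jumpTime s w (k + 1) ≤ t) :=
        (Filter.eventually_all_finset G).2 fun z _ => hfin z
      filter_upwards [this] with k hk hkG
      exact hk _ hkG ⟨rfl, hpos _, hA' k⟩
    obtain ⟨N0, hN0⟩ := eventually_atTop.1 hev
    obtain ⟨m, hmn, h0, h1⟩ := exists_last_visit (fun k => walk w k ∈ G) N0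
    refine ⟨m, h0, fun hm0 => ?_, ?_⟩
    · obtain ⟨k, rfl⟩ := Nat.exists_eq_succ_of_ne_zero hm0
      exact hA' k
    -- The surcharge alone exceeds `t` after `N` steps away from `G`.
    · obtain ⟨N, hN⟩ := exists_nat_gt (t / η)
      refine le_trans (ENNReal.ofReal_le_ofReal ?_)
        (le_hitCost_shift (G := (G : Set ℤ)) (N := N) hs hη.le hw fun j hj hj2 => ?_)
      · rw [div_lt_iff₀ hη] at hN
        have h2 := hmono (Nat.le_add_right m N)
        have h3 := hpos m
        linarith
      · rcases lt_or_ge j N0 with h | h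
        · exact h1 j hj h
        · exact hN0 j h

lemma measurableSet_visit (s : ℤ → ℝ) (t : ℝ) (z : ℤ) (k : ℕ) : MeasurableSet
    {w : Noise | walk w k = z ∧ 0 ≤ jumpTime s w (k + 1) ∧ jumpTime s w (k + 1) ≤ t} :=
  (measurableSet_eq_fun (measurable_walk k) measurable_const).inter
    ((measurableSet_le measurable_const (measurable_jumpTime s (k + 1))).inter
      (measurableSet_le (measurable_jumpTime s (k + 1)) measurable_const))

/-- Borel–Cantelli: the expected number of visits to `z` ending in `[0, t]` is at most `t / s z`. -/
lemma ae_finite_visits (hs : ∀ x, 0 < s x) (t : ℝ) :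
    ∀ᵐ w ∂noiseLaw, ∀ z, ∀ᶠ k in atTop, ¬ (walk w k = z ∧
      0 ≤ jumpTime s w (k + 1) ∧ jumpTime s w (k + 1) ≤ t) := by
  rw [ae_all_iff]
  intro z
  refine ae_eventually_notMem (μ := noiseLaw) (s := fun k =>
    {w | walk w k = z ∧ 0 ≤ jumpTime s w (k + 1) ∧ jumpTime s w (k + 1) ≤ t}) ?_
  have hg : Measurable (Function.uncurry fun (u : ℝ) (_ : ℤ × Noise) =>
      (Set.Icc (0 : ℝ) t).indicator (1 : ℝ → ℝ≥0∞) u) :=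
    (measurable_one.indicator measurableSet_Icc).comp measurable_fst
  have h := tsum_lintegral_visit_end_le hs z hg
  have h1 : ∀ k, noiseLaw
      {w | walk w k = z ∧ 0 ≤ jumpTime s w (k + 1) ∧ jumpTime s w (k + 1) ≤ t}
      = ∫⁻ w, (if walk w k = z then
        (Set.Icc (0 : ℝ) t).indicator (1 : ℝ → ℝ≥0∞) (jumpTime s w (k + 1)) else 0)
        ∂noiseLaw := by
    intro k
    rw [← lintegral_indicator_one (measurableSet_visit s t z k)]
    refine lintegral_congr fun w => ?_
    by_cases hz : walk w k = z <;> simp [Set.indicator, hz]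
  simp_rw [h1]
  refine ne_top_of_le_ne_top ?_ h
  simp only [lintegral_const, measure_univ, mul_one]
  rw [lintegral_indicator_one measurableSet_Icc, Real.volume_Icc]
  exact ENNReal.mul_ne_top ENNReal.ofReal_ne_top ENNReal.ofReal_ne_top

lemma volume_residual_le (t : ℝ) (e : ℝ≥0∞) :
    volume {u : ℝ | (0 ≤ u ∧ u ≤ t) ∧ ENNReal.ofReal (t - u) ≤ e} ≤ min (ENNReal.ofReal t) e := by
  refine le_min ?_ ?_
  · calc _ ≤ volume (Set.Icc 0 t) := measure_mono fun u hu => hu.1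
      _ = _ := by simp
  · rcases eq_or_ne e ⊤ with rfl | he
    · exact le_top
    · calc _ ≤ volume (Set.Icc (t - e.toReal) t) := by
            refine measure_mono fun u hu => ⟨?_, hu.1.2⟩
            have := (ENNReal.ofReal_le_iff_le_toReal he).1 hu.2
            linarith
        _ = e := by rw [Real.volume_Icc]; simp [he]

/-- The mean hitting time of `G` from `x`, truncated at `t`. -/
def meanHit (s : ℤ → ℝ) (η t : ℝ) (G : Set ℤ) (x : ℤ) : ℝ≥0∞ :=
  ∫⁻ w, min (ENNReal.ofReal t) (hitCost s η G x w) ∂noiseLaw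

/-- The intensity bound is applied to the indicator that the return takes at least `t - u`.
Integrating over the end time `u` first turns this indicator into at most `min t (hitCost …)`, by
`volume_residual_le`. -/
lemma measure_awayAfter_le (hs : ∀ x, 0 < s x) (t : ℝ) (G : Set ℤ) (z : ℤ) :
    noiseLaw (⋃ k, awayAfter s η t G z k) ≤ ENNReal.ofReal (1 / s z) *
      ((meanHit s η t G (z - 1) + meanHit s η t G (z + 1)) / 2) := by
  have hhit : Measurable fun p : ℤ × Noise => hitCost s η G (z + p.1) p.2 :=
    measurable_uncurry_hitCost.comp (f := fun p : ℤ × Noise => (z + p.1, p.2)) (by fun_prop)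
  set B : Set (ℝ × ℤ × Noise) :=
    {q | (0 ≤ q.1 ∧ q.1 ≤ t) ∧ ENNReal.ofReal (t - q.1) ≤ hitCost s η G (z + q.2.1) q.2.2}
    with hB
  have hBm : MeasurableSet B :=
    ((measurableSet_le measurable_const measurable_fst).inter
      (measurableSet_le measurable_fst measurable_const)).inter
      (measurableSet_le (by fun_prop) (hhit.comp measurable_snd))
  have hg : Measurable (Function.uncurry fun (u : ℝ) (p : ℤ × Noise) =>
      B.indicator (1 : ℝ × ℤ × Noise → ℝ≥0∞) (u, p)) :=
    measurable_one.indicator hBm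
  refine le_trans (measure_iUnion_le _) ?_
  have h1 : ∀ k, noiseLaw (awayAfter s η t G z k)
      = ∫⁻ w, (if walk w k = z then
          B.indicator (1 : ℝ × ℤ × Noise → ℝ≥0∞) (jumpTime s w (k + 1), ((w k).1, shift (k + 1) w))
          else 0) ∂noiseLaw := by
    intro k
    have hm : MeasurableSet (awayAfter s η t G z k) := by
      refine (measurableSet_eq_fun (measurable_walk k) measurable_const).inter
        (hBm.preimage (f := fun w : Noise =>
          (jumpTime s w (k + 1), ((w k).1, shift (k + 1) w))) (by fun_prop))
    rw [← lintegral_indicator_one hm]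
    refine lintegral_congr fun w => ?_
    by_cases hz : walk w k = z <;> simp [Set.indicator, hz, awayAfter, hB]
  simp_rw [h1]
  refine le_trans (tsum_lintegral_visit_end_le hs z hg) ?_
  gcongr
  rw [lintegral_lintegral_swap hg.aemeasurable]
  have h2 : ∀ p : ℤ × Noise, ∫⁻ u, B.indicator (1 : ℝ × ℤ × Noise → ℝ≥0∞) (u, p)
      ≤ min (ENNReal.ofReal t) (hitCost s η G (z + p.1) p.2) := by
    intro p
    refine le_trans (le_of_eq ?_) (volume_residual_le t _)
    exact lintegral_indicator_one (hBm.preimage (f := fun u : ℝ => (u, p)) (by fun_prop))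
  refine le_trans (lintegral_mono h2) (le_of_eq ?_)
  rw [lintegral_prod _ (measurable_const.min hhit).aemeasurable, lintegral_stepLaw]
  simp only [meanHit, sub_eq_add_neg]

/-- The quenched probability of not being in `G` at time `t`, in terms of mean truncated hitting
times of `G`. -/
theorem measure_process_notMem_le (hs : ∀ x, 0 < s x) (hη : 0 < η) {t : ℝ} (ht : 0 < t)
    (G : Finset ℤ) :
    noiseLaw {w | process s w t ∉ G} ≤ meanHit s η t G 0 / ENNReal.ofReal t +
      ∑ z ∈ G, ENNReal.ofReal (1 / s z) *
        ((meanHit s η t G (z - 1) + meanHit s η t G (z + 1)) / 2) := by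
  have hsub : noiseLaw {w | process s w t ∉ G} ≤ noiseLaw
      ({w | ENNReal.ofReal t ≤ hitCost s η G 0 w} ∪ ⋃ z ∈ G, ⋃ k, awayAfter s η t G z k) := by
    refine measure_mono_ae ?_
    filter_upwards [ae_noise_pos, ae_finite_visits hs t] with w hw hfin hX
    rcases away_cases hs hη hw hfin hX with h | ⟨z, hz, k, h⟩
    · exact Or.inl h
    · exact Or.inr (Set.mem_biUnion hz (Set.mem_iUnion.2 ⟨k, h⟩))
  refine hsub.trans ((measure_union_le _ _).trans (add_le_add ?_ ?_))
  · have h1 : {w | ENNReal.ofReal t ≤ hitCost s η G 0 w}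
        = {w | ENNReal.ofReal t ≤ min (ENNReal.ofReal t) (hitCost s η G 0 w)} := by
      ext w; simp
    rw [h1]
    exact meas_ge_le_lintegral_div
      (measurable_const.min (measurable_hitCost 0)).aemeasurable (by simpa using ht)
      ENNReal.ofReal_ne_top
  · exact (measure_biUnion_finset_le G _).trans
      (Finset.sum_le_sum fun z _ => measure_awayAfter_le hs t G z)

end

section

open scoped ENNReal

/-! ### Explicit superharmonic functions -/

/-- The Green function bound `min |x - z| |y - z|` of the walk killed at `z`. -/
def killedGreen (z y x : ℤ) : ℤ := min |x - z| |y - z|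

lemma killedGreen_nonneg (z y x : ℤ) : 0 ≤ killedGreen z y x :=
  le_min (abs_nonneg _) (abs_nonneg _)

/-- As a function of `x`, the minimum is concave on each side of `z`, with a kink of size one at
`y`. Its reflection in `z` adds a second concave kink, which only helps. -/
lemma killedGreen_superharmonic {z x : ℤ} (hx : x ≠ z) (y : ℤ) :
    killedGreen z y (x - 1) + killedGreen z y (x + 1) + (if y = x then 1 else 0)
      ≤ 2 * killedGreen z y x := by
  simp only [killedGreen, abs_eq_max_neg]
  split_ifs <;> omega

variable {s : ℤ → ℝ} {η t : ℝ}

/-- The Green sum pays for the time spent in `J` before `z` is hit. The function `b` pays for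
leaving `J`: it must reach the cap `t` outside `J ∪ G` and be superharmonic inside. -/
lemma meanHit_le (hs : ∀ x, 0 < s x) (hη : 0 ≤ η) {G : Set ℤ} {J : Finset ℤ} {z : ℤ} {b : ℤ → ℝ}
    (hb : ∀ x, 0 ≤ b x)
    (hcond : ∀ x, x ∉ G → t ≤ b x ∨ (x ∈ J ∧ x ≠ z ∧ (b (x - 1) + b (x + 1)) / 2 ≤ b x)) (x : ℤ) :
    meanHit s η t G x
      ≤ ENNReal.ofReal (∑ y ∈ J, (s y + η) * (2 * killedGreen z y x) + b x) := by
  have hsum : ∀ x, 0 ≤ ∑ y ∈ J, (s y + η) * (2 * (killedGreen z y x : ℝ)) := fun x =>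
    Finset.sum_nonneg fun y _ => mul_nonneg (add_nonneg (hs y).le hη)
      (mul_nonneg zero_le_two (by exact_mod_cast killedGreen_nonneg z y x))
  refine lintegral_min_hitCost_le
    (h := fun x => ∑ y ∈ J, (s y + η) * (2 * (killedGreen z y x : ℝ)) + b x)
    hs hη (fun x => add_nonneg (hsum x) (hb x)) (fun x hx => ?_) x
  rcases hcond x hx with h | ⟨hJ, hz, h⟩
  · exact (min_le_left _ _).trans (h.trans (le_add_of_nonneg_left (hsum x)))
  · refine (min_le_right _ _).trans ?_
    have key : s x + η + (∑ y ∈ J, (s y + η) * (2 * (killedGreen z y (x - 1) : ℝ))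
        + ∑ y ∈ J, (s y + η) * (2 * (killedGreen z y (x + 1) : ℝ))) / 2
        ≤ ∑ y ∈ J, (s y + η) * (2 * (killedGreen z y x : ℝ)) := by
      have h1 : s x + η = ∑ y ∈ J, (s y + η) * (if y = x then 1 else 0) := by
        simp [hJ]
      rw [h1, ← Finset.sum_add_distrib, Finset.sum_div, ← Finset.sum_add_distrib]
      refine Finset.sum_le_sum fun y _ => ?_
      have h2 : (killedGreen z y (x - 1) + killedGreen z y (x + 1) + (if y = x then 1 else 0) : ℝ)
          ≤ 2 * killedGreen z y x := by exact_mod_cast killedGreen_superharmonic hz y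
      have h3 := mul_le_mul_of_nonneg_left h2 (add_nonneg (hs y).le hη)
      linarith
    linarith

/-- Truncated mean hitting time of two sites from a point between them. -/
lemma meanHit_pair_le (hs : ∀ x, 0 < s x) (hη : 0 ≤ η) (ht : 0 ≤ t) {a b : ℤ} (ha : a < 0)
    (hb : 0 < b) :
    meanHit s η t {b, a} 0 ≤ ENNReal.ofReal (2 * b * ∑ y ∈ Finset.Ioo a b, (s y + η)) := by
  refine (meanHit_le (J := Finset.Ioo a b) (z := b)
    (b := fun x => if a ≤ x ∧ x ≤ b then 0 else t) hs hη
    (fun x => by split_ifs <;> simp [ht]) (fun x hx => ?_) 0).trans (ENNReal.ofReal_le_ofReal ?_)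
  · simp only [Set.mem_insert_iff, Set.mem_singleton_iff, not_or] at hx
    by_cases h : a < x ∧ x < b
    · refine Or.inr ⟨Finset.mem_Ioo.2 h, hx.1, ?_⟩
      rw [if_pos ⟨by omega, by omega⟩, if_pos ⟨by omega, by omega⟩, if_pos ⟨by omega, by omega⟩]
      simp
    · left
      rw [if_neg (by omega)]
  · rw [if_pos ⟨ha.le, hb.le⟩, add_zero, Finset.mul_sum]
    refine Finset.sum_le_sum fun y _ => ?_
    have h1 : (killedGreen b y 0 : ℝ) ≤ b := by
      have : killedGreen b y 0 ≤ b := (min_le_left _ _).trans (by simp [abs_of_pos hb])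
      exact_mod_cast this
    have h2 := mul_le_mul_of_nonneg_left h1 (add_nonneg (hs y).le hη)
    linarith

/-- Truncated mean return time to `z` from its neighbours. -/
lemma meanHit_neighbour_le (hs : ∀ x, 0 < s x) (hη : 0 ≤ η) (ht : 0 ≤ t) {G : Set ℤ} {z : ℤ}
    (hz : z ∈ G) {D : ℤ} (hD : 0 < D) {x : ℤ} (hx : |x - z| = 1) :
    meanHit s η t G x ≤ ENNReal.ofReal
      (2 * ∑ y ∈ (Finset.Ioo (z - D) (z + D)).erase z, (s y + η) + t / D) := by
  have hD' : (0 : ℝ) < D := by exact_mod_cast hD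
  -- Gambler's ruin: from a neighbour of `z`, distance `D` is reached before `z` with probability `1
  -- / D`, and this is charged the full `t`.
  refine (meanHit_le (J := (Finset.Ioo (z - D) (z + D)).erase z) (z := z)
    (b := fun x => t / D * (|x - z| : ℤ)) hs hη
    (fun x => mul_nonneg (div_nonneg ht hD'.le) (by exact_mod_cast abs_nonneg _))
    (fun x hx => ?_) x).trans (ENNReal.ofReal_le_ofReal ?_)
  · have hxz : x ≠ z := fun h => hx (h ▸ hz)
    by_cases h : |x - z| < D
    · refine Or.inr ⟨?_, hxz, ?_⟩
      · have := abs_lt.1 h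
        simp only [Finset.mem_erase, Finset.mem_Ioo]
        omega
      · have h1 : |x - 1 - z| + |x + 1 - z| ≤ 2 * |x - z| := by
          simp only [abs_eq_max_neg]; omega
        have h2 : ((|x - 1 - z| : ℤ) : ℝ) + (|x + 1 - z| : ℤ) ≤ 2 * (|x - z| : ℤ) := by
          exact_mod_cast h1
        have h3 := mul_le_mul_of_nonneg_left h2 (div_nonneg ht hD'.le)
        linarith
    · left
      have h1 : (D : ℝ) ≤ (|x - z| : ℤ) := by exact_mod_cast not_lt.1 h
      calc t = t / D * D := by field_simp
        _ ≤ _ := mul_le_mul_of_nonneg_left h1 (div_nonneg ht hD'.le)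
  · rw [hx, Int.cast_one, mul_one, Finset.mul_sum]
    refine add_le_add (Finset.sum_le_sum fun y _ => ?_) le_rfl
    have h1 : (killedGreen z y x : ℝ) ≤ 1 := by
      have : killedGreen z y x ≤ 1 := (min_le_left _ _).trans hx.le
      exact_mod_cast this
    have h2 := mul_le_mul_of_nonneg_left h1 (add_nonneg (hs y).le hη)
    linarith

lemma sum_add_const_le {J : Finset ℤ} {B : ℝ} (hsum : ∑ y ∈ J, s y ≤ B)
    (hη : J.card * η ≤ B) : ∑ y ∈ J, (s y + η) ≤ 2 * B := by
  rw [Finset.sum_add_distrib, Finset.sum_const, nsmul_eq_mul]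
  linarith

/-- Quenched localisation estimate: if all the traps between `a < 0 < b`, and all the other traps
within distance `D` of `a` and `b`, have total depth at most `B`, then the process is at `a` or `b`
with high probability. -/
theorem quenched_localisation (hs : ∀ x, 0 < s x) (ht : 0 < t) {a b : ℤ} (ha : a < 0) (hb : 0 < b)
    {D : ℤ} (hD : 0 < D) {B : ℝ} (hB : 0 < B)
    (hmid : ∑ y ∈ Finset.Ioo a b, s y ≤ B)
    (hsa : ∑ y ∈ (Finset.Ioo (a - D) (a + D)).erase a, s y ≤ B)
    (hsb : ∑ y ∈ (Finset.Ioo (b - D) (b + D)).erase b, s y ≤ B) :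
    1 - (4 * b * B / t + ((4 * B + t / D) / s b + (4 * B + t / D) / s a))
      ≤ quenchedProb s t {b, a} := by
  set C : ℕ := (Finset.Ioo a b).card + ((Finset.Ioo (a - D) (a + D)).erase a).card
    + ((Finset.Ioo (b - D) (b + D)).erase b).card with hC
  -- The surcharge over any of the three windows is then at most `B`, so it at most doubles the
  -- bound on the depth.
  set η : ℝ := B / (C + 1) with hηdef
  have hC0 : (0 : ℝ) < C + 1 := by positivity
  have hη : 0 < η := div_pos hB hC0
  have hcard : ∀ n : ℕ, n ≤ C → n * η ≤ B := by
    intro n hn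
    have : (n : ℝ) ≤ C + 1 := by
      have : (n : ℝ) ≤ C := by exact_mod_cast hn
      linarith
    calc n * η ≤ (C + 1) * η := mul_le_mul_of_nonneg_right this hη.le
      _ = B := by rw [hηdef]; field_simp
  have hmid' := sum_add_const_le hmid (hcard _ (by omega))
  have hsa' := sum_add_const_le hsa (hcard _ (by omega))
  have hsb' := sum_add_const_le hsb (hcard _ (by omega))
  have hD' : (0 : ℝ) < D := by exact_mod_cast hD
  have hb' : (0 : ℝ) < b := by exact_mod_cast hb
  have htD : 0 < t / D := div_pos ht hD'
  have h0 : meanHit s η t {b, a} 0 ≤ ENNReal.ofReal (4 * b * B) := by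
    refine (meanHit_pair_le hs hη.le ht.le ha hb).trans (ENNReal.ofReal_le_ofReal ?_)
    have := mul_le_mul_of_nonneg_left hmid' hb'.le
    linarith
  have hna : ∀ x, |x - a| = 1 → meanHit s η t {b, a} x ≤ ENNReal.ofReal (4 * B + t / D) :=
    fun x hx => (meanHit_neighbour_le hs hη.le ht.le (by simp) hD hx).trans
      (ENNReal.ofReal_le_ofReal (by linarith))
  have hnb : ∀ x, |x - b| = 1 → meanHit s η t {b, a} x ≤ ENNReal.ofReal (4 * B + t / D) :=
    fun x hx => (meanHit_neighbour_le hs hη.le ht.le (by simp) hD hx).trans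
      (ENNReal.ofReal_le_ofReal (by linarith))
  have hterm : ∀ z, (∀ x, |x - z| = 1 → meanHit s η t {b, a} x ≤ ENNReal.ofReal (4 * B + t / D)) →
      ENNReal.ofReal (1 / s z) *
        ((meanHit s η t {b, a} (z - 1) + meanHit s η t {b, a} (z + 1)) / 2)
      ≤ ENNReal.ofReal ((4 * B + t / D) / s z) := by
    intro z hz
    have h1 := hz (z - 1) (by simp)
    have h2 := hz (z + 1) (by simp)
    rw [show (4 * B + t / D) / s z = 1 / s z * (4 * B + t / D) by ring,
      ENNReal.ofReal_mul (one_div_nonneg.2 (hs z).le)]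
    refine mul_le_mul' le_rfl ?_
    refine ENNReal.div_le_of_le_mul ?_
    rw [mul_two]
    exact add_le_add h1 h2
  have hmain := measure_process_notMem_le hs hη ht {b, a}
  have hab : b ≠ a := by omega
  rw [Finset.sum_pair hab] at hmain
  simp only [Finset.coe_insert, Finset.coe_singleton] at hmain
  have hfin : noiseLaw {w | process s w t ∉ ({b, a} : Finset ℤ)} ≤
      ENNReal.ofReal (4 * b * B / t + ((4 * B + t / D) / s b + (4 * B + t / D) / s a)) := by
    have hsb0 := hs b
    have hsa0 := hs a
    rw [ENNReal.ofReal_add (by positivity) (by positivity),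
      ENNReal.ofReal_add (by positivity) (by positivity)]
    refine hmain.trans (add_le_add ?_ (add_le_add (hterm b hnb) (hterm a hna)))
    rw [ENNReal.ofReal_div_of_pos ht]
    exact ENNReal.div_le_div_right h0 _
  have hreal : noiseLaw.real {w | process s w t ∉ ({b, a} : Finset ℤ)} ≤
      4 * b * B / t + ((4 * B + t / D) / s b + (4 * B + t / D) / s a) := by
    have hsb0 := hs b
    have hsa0 := hs a
    exact ENNReal.toReal_le_of_le_ofReal (by positivity) hfin
  have hone : 1 ≤ noiseLaw.real {w | process s w t ∈ ({b, a} : Set ℤ)} +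
      noiseLaw.real {w | process s w t ∉ ({b, a} : Finset ℤ)} := by
    have hu : {w | process s w t ∈ ({b, a} : Set ℤ)} ∪
        {w | process s w t ∉ ({b, a} : Finset ℤ)} = Set.univ := by
      ext w; simp [or_iff_not_imp_left]
    calc (1 : ℝ) = noiseLaw.real Set.univ := by simp
      _ = noiseLaw.real _ := by rw [← hu]
      _ ≤ _ := measureReal_union_le _ _
  unfold quenchedProb
  linarith

end

section

/-! ### Slowly varying tails -/

/-- Iteration over dyadic blocks. With error `ε / 8` the recursion has fixed point `ε / 2`, and the
initial bound decays like `(3 / 4) ^ n`. -/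
lemma tendsto_zero_of_le_half {r : ℝ → ℝ}
    (hbdd : ∀ a, 0 < a → ∃ B, 0 ≤ B ∧ ∀ x, a ≤ x → x ≤ 2 * a → r x ≤ B)
    (hrec : ∀ ε, 0 < ε → ∀ᶠ x in atTop, r x ≤ 3 / 4 * r (x / 2) + ε) {ε : ℝ} (hε : 0 < ε) :
    ∀ᶠ x in atTop, r x ≤ ε := by
  obtain ⟨x1, hx1⟩ := eventually_atTop.1 (hrec (ε / 8) (by positivity))
  set x0 := max x1 1
  have hx0 : 0 < x0 := lt_of_lt_of_le one_pos (le_max_right _ _)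
  obtain ⟨B, hB, hr⟩ := hbdd x0 hx0
  have key : ∀ n : ℕ, ∀ x, 2 ^ n * x0 ≤ x → x ≤ 2 ^ (n + 1) * x0 →
      r x ≤ (3 / 4) ^ n * B + ε / 2 := by
    intro n
    induction n with
    | zero =>
      intro x h1 h2
      have := hr x (by simpa using h1) (by simpa using h2)
      simp only [pow_zero, one_mul]
      linarith
    | succ n ih =>
      intro x h1 h2
      have h3 := ih (x / 2) (by rw [pow_succ] at h1; linarith) (by rw [pow_succ] at h2; linarith)
      have h4 : x1 ≤ x := by
        refine le_trans (le_max_left x1 1) (le_trans ?_ h1)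
        exact le_mul_of_one_le_left hx0.le (one_le_pow₀ one_le_two)
      have h5 := hx1 x h4
      rw [pow_succ]
      linarith
  obtain ⟨N, hN⟩ : ∃ N : ℕ, (3 / 4 : ℝ) ^ N * B ≤ ε / 2 := by
    have h : Tendsto (fun n : ℕ => (3 / 4 : ℝ) ^ n * B) atTop (𝓝 (0 * B)) :=
      (tendsto_pow_atTop_nhds_zero_of_lt_one (by norm_num) (by norm_num)).mul_const B
    rw [zero_mul] at h
    exact (h.eventually_le_const (by positivity)).exists
  filter_upwards [eventually_ge_atTop (2 ^ N * x0)] with x hx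
  have h2N : (2 : ℝ) ^ N ≤ x / x0 := (le_div_iff₀ hx0).2 hx
  obtain ⟨n, hn1, hn2⟩ := exists_nat_pow_near (le_trans (one_le_pow₀ one_le_two) h2N) one_lt_two
  have hNn : N ≤ n := by
    have := lt_of_le_of_lt h2N hn2
    have := (pow_lt_pow_iff_right₀ (one_lt_two (α := ℝ))).1 this
    omega
  have h := key n x ((le_div_iff₀ hx0).1 hn1) ((div_lt_iff₀ hx0).1 hn2).le
  have h' : (3 / 4 : ℝ) ^ n * B ≤ (3 / 4) ^ N * B :=
    mul_le_mul_of_nonneg_right (pow_le_pow_of_le_one (by norm_num) (by norm_num) hNn) hB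
  linarith

section Tail

variable {Ω : Type*} [MeasurableSpace Ω] {P : Measure Ω} {Y : Ω → ℝ}

/-- The tail of `Y`. -/
def tail (P : Measure Ω) (Y : Ω → ℝ) (x : ℝ) : ℝ := P.real {ω | x < Y ω}

/-- The mean of `Y` restricted to `Y ≤ x`. -/
def truncMean (P : Measure Ω) (Y : Ω → ℝ) (x : ℝ) : ℝ := ∫ ω, (if Y ω ≤ x then Y ω else 0) ∂P

lemma tail_nonneg (x : ℝ) : 0 ≤ tail P Y x := measureReal_nonneg

lemma invTail_eq (x : ℝ) : invTail P Y x = 1 / tail P Y x := rfl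

lemma ae_trunc_bounds (hpos : ∀ᵐ ω ∂P, 0 < Y ω) {x : ℝ} (hx : 0 ≤ x) :
    ∀ᵐ ω ∂P, 0 ≤ (if Y ω ≤ x then Y ω else 0) ∧ (if Y ω ≤ x then Y ω else 0) ≤ x := by
  filter_upwards [hpos] with ω hω
  split_ifs with h
  · exact ⟨hω.le, h⟩
  · exact ⟨le_rfl, hx⟩

lemma truncMean_nonneg (hpos : ∀ᵐ ω ∂P, 0 < Y ω) {x : ℝ} (hx : 0 ≤ x) :
    0 ≤ truncMean P Y x :=
  integral_nonneg_of_ae ((ae_trunc_bounds hpos hx).mono fun _ h => h.1)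

variable [IsProbabilityMeasure P]

lemma tail_antitone : Antitone (tail P Y) := fun _ _ h =>
  measureReal_mono fun _ hω => lt_of_le_of_lt h hω

lemma tail_le_one (x : ℝ) : tail P Y x ≤ 1 := measureReal_le_one

/-- A vanishing tail would give `invTail = 1 / 0 = 0` in Lean, and then the ratio for `v = 1` would
be `0 / 0 = 0`, not close to `1`. Finiteness of `L` thus follows from slow variation. -/
lemma tail_pos (h : SlowlyVarying (invTail P Y)) (x : ℝ) : 0 < tail P Y x := by
  have h1 := h 1 one_pos
  simp only [mul_one] at h1
  have h2 : ∀ᶠ u in atTop, (1 / 2 : ℝ) < invTail P Y u / invTail P Y u :=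
    h1.eventually_const_lt (by norm_num)
  obtain ⟨u, hu, hxu⟩ := (h2.and (eventually_ge_atTop x)).exists
  refine lt_of_lt_of_le ?_ (tail_antitone hxu)
  refine lt_of_le_of_ne (tail_nonneg u) fun h0 => ?_
  rw [invTail_eq, ← h0] at hu
  norm_num at hu

lemma tendsto_tail_ratio (h : SlowlyVarying (invTail P Y)) {v : ℝ} (hv : 0 < v) :
    Tendsto (fun u => tail P Y (u * v) / tail P Y u) atTop (𝓝 1) := by
  have h1 := (h v hv).inv₀ one_ne_zero
  rw [inv_one] at h1
  refine h1.congr fun u => ?_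
  have := (tail_pos h u).ne'
  have := (tail_pos h (u * v)).ne'
  rw [invTail_eq, invTail_eq]
  field_simp

lemma tendsto_tail (hY : Measurable Y) : Tendsto (tail P Y) atTop (𝓝 0) := by
  have h : Tendsto (fun x => P {ω | x < Y ω}) atTop (𝓝 (P (⋂ x : ℝ, {ω | x < Y ω}))) := by
    refine tendsto_measure_iInter_atTop
      (fun x => (measurableSet_lt measurable_const hY).nullMeasurableSet)
      (fun _ _ hxy ω hω => lt_of_le_of_lt hxy hω) ⟨0, measure_ne_top _ _⟩
  have h0 : (⋂ x : ℝ, {ω | x < Y ω}) = ∅ := by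
    ext ω
    simp only [Set.mem_iInter, Set.mem_ofPred_eq, Set.mem_empty_iff_false, iff_false, not_forall,
      not_lt]
    exact ⟨Y ω, le_rfl⟩
  rw [h0, measure_empty] at h
  exact (ENNReal.tendsto_toReal ENNReal.zero_ne_top).comp h

lemma one_le_invTail (h : SlowlyVarying (invTail P Y)) (x : ℝ) : 1 ≤ invTail P Y x := by
  rw [invTail_eq, le_div_iff₀ (tail_pos h x), one_mul]
  exact tail_le_one x

lemma invTail_mono (h : SlowlyVarying (invTail P Y)) : Monotone (invTail P Y) := fun _ y hxy =>
  one_div_le_one_div_of_le (tail_pos h y) (tail_antitone hxy)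

lemma measureReal_Ioc_eq (hY : Measurable Y) {x y : ℝ} (hxy : x ≤ y) :
    P.real {ω | x < Y ω ∧ Y ω ≤ y} = tail P Y x - tail P Y y := by
  have hsub : {ω | y < Y ω} ⊆ {ω | x < Y ω} := fun ω hω => lt_of_le_of_lt hxy hω
  rw [tail, tail, ← measureReal_sdiff hsub (measurableSet_lt measurable_const hY)]
  congr 1
  ext ω
  simp

lemma measurable_trunc (hY : Measurable Y) (x : ℝ) :
    Measurable fun ω => if Y ω ≤ x then Y ω else 0 :=
  Measurable.ite (measurableSet_le hY measurable_const) hY measurable_const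

lemma integrable_trunc (hY : Measurable Y) (hpos : ∀ᵐ ω ∂P, 0 < Y ω) {x : ℝ} (hx : 0 ≤ x) :
    Integrable (fun ω => if Y ω ≤ x then Y ω else 0) P :=
  Integrable.of_bound (measurable_trunc hY x).aestronglyMeasurable x <| by
    filter_upwards [ae_trunc_bounds hpos hx] with ω hω
    rw [Real.norm_eq_abs, abs_of_nonneg hω.1]
    exact hω.2

lemma truncMean_le (hY : Measurable Y) (hpos : ∀ᵐ ω ∂P, 0 < Y ω) {x : ℝ} (hx : 0 ≤ x) :
    truncMean P Y x ≤ x := by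
  have := integral_mono_ae (integrable_trunc hY hpos hx) (integrable_const x)
    ((ae_trunc_bounds hpos hx).mono fun _ h => h.2)
  simpa [truncMean] using this

lemma truncMean_le_half (hY : Measurable Y) (hpos : ∀ᵐ ω ∂P, 0 < Y ω) {x : ℝ} (hx : 0 ≤ x) :
    truncMean P Y x ≤ truncMean P Y (x / 2) + x * (tail P Y (x / 2) - tail P Y x) := by
  set A : Set Ω := {ω | x / 2 < Y ω ∧ Y ω ≤ x} with hA
  have hAm : MeasurableSet A :=
    (measurableSet_lt measurable_const hY).inter (measurableSet_le hY measurable_const)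
  have hint : Integrable (A.indicator fun _ => x) P := (integrable_const x).indicator hAm
  have h1 : ∫ ω, A.indicator (fun _ => x) ω ∂P = x * (tail P Y (x / 2) - tail P Y x) := by
    rw [integral_indicator hAm, setIntegral_const, hA, measureReal_Ioc_eq hY (by linarith),
      smul_eq_mul, mul_comm]
  rw [← h1, truncMean, truncMean, ← integral_add (integrable_trunc hY hpos (by positivity)) hint]
  refine integral_mono_ae (integrable_trunc hY hpos hx)
    ((integrable_trunc hY hpos (by positivity)).add hint) ?_
  filter_upwards [hpos] with ω hω
  simp only [Set.indicator, hA, Set.mem_ofPred_eq]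
  split_ifs <;> grind

/-- For a slowly varying tail the truncated mean at `x` is negligible with respect to
`x * tail x`. -/
lemma truncMean_isLittleO (hY : Measurable Y) (hpos : ∀ᵐ ω ∂P, 0 < Y ω)
    (h : SlowlyVarying (invTail P Y)) {ε : ℝ} (hε : 0 < ε) :
    ∀ᶠ x in atTop, truncMean P Y x ≤ ε * (x * tail P Y x) := by
  have hmain : ∀ᶠ x in atTop, truncMean P Y x / (x * tail P Y x) ≤ ε := by
    refine tendsto_zero_of_le_half (fun a ha => ?_) (fun δ hδ => ?_) hε
    · refine ⟨1 / tail P Y (2 * a), (one_div_pos.2 (tail_pos h _)).le, fun x h1 h2 => ?_⟩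
      have hx : 0 < x := lt_of_lt_of_le ha h1
      have hq := tail_pos h x
      have hq2 := tail_pos h (2 * a)
      calc truncMean P Y x / (x * tail P Y x) ≤ x / (x * tail P Y x) := by
            gcongr; exact truncMean_le hY hpos hx.le
        _ = 1 / tail P Y x := by field_simp
        _ ≤ _ := one_div_le_one_div_of_le hq2 (tail_antitone h2)
    -- Halving the argument contributes a factor `1 / 2`, and the ratio of tails at most `3 / 2`:
    -- hence the contraction factor `3 / 4`. The mass in `(x / 2, x]` is the error term.
    · have hr := tendsto_tail_ratio h (v := 1 / 2) (by norm_num)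
      filter_upwards [hr.eventually_le_const (u := 1 + min δ (1 / 2))
        (by have : 0 < min δ (1 / 2) := lt_min hδ (by norm_num)
            linarith), eventually_gt_atTop 0] with x hx hx0
      have hq := tail_pos h x
      have hq2 := tail_pos h (x / 2)
      rw [mul_one_div, div_le_iff₀ hq] at hx
      have hδ1 : min δ (1 / 2) ≤ δ := min_le_left _ _
      have hδ2 : min δ (1 / 2) ≤ 1 / 2 := min_le_right _ _
      have hφ := truncMean_nonneg (P := P) hpos (x := x / 2) (by positivity)
      have h1 : tail P Y (x / 2) ≤ (1 + δ) * tail P Y x :=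
        hx.trans (mul_le_mul_of_nonneg_right (by linarith) hq.le)
      have h2 : tail P Y (x / 2) ≤ 3 / 2 * tail P Y x :=
        hx.trans (mul_le_mul_of_nonneg_right (by linarith) hq.le)
      have h3 := truncMean_le_half hY hpos hx0.le
      rw [div_le_iff₀ (mul_pos hx0 hq)]
      have h4 : x * (tail P Y (x / 2) - tail P Y x) ≤ δ * (x * tail P Y x) := by nlinarith
      have h5 : truncMean P Y (x / 2) ≤
          3 / 4 * (truncMean P Y (x / 2) / (x / 2 * tail P Y (x / 2))) * (x * tail P Y x) := by
        have : 3 / 4 * (truncMean P Y (x / 2) / (x / 2 * tail P Y (x / 2))) * (x * tail P Y x)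
            = truncMean P Y (x / 2) * ((3 / 2 * tail P Y x) / tail P Y (x / 2)) := by
          field_simp; ring
        rw [this]
        exact le_mul_of_one_le_right hφ ((one_le_div hq2).2 h2)
      linarith
  filter_upwards [hmain, eventually_gt_atTop 0] with x hx hx0
  rwa [div_le_iff₀ (mul_pos hx0 (tail_pos h x))] at hx

/-! ### The level -/

lemma nonempty_level (h : SlowlyVarying (invTail P Y)) (t : ℝ) :
    {x : ℝ | 0 ≤ x ∧ t ≤ x * invTail P Y x}.Nonempty :=
  ⟨max t 0, le_max_right _ _, (le_max_left t 0).trans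
    (le_mul_of_one_le_right (le_max_right _ _) (one_le_invTail h _))⟩

lemma bddBelow_level (L : ℝ → ℝ) (t : ℝ) : BddBelow {x : ℝ | 0 ≤ x ∧ t ≤ x * L x} :=
  ⟨0, fun _ hx => hx.1⟩

lemma mul_invTail_le (h : SlowlyVarying (invTail P Y)) {x y : ℝ} (hx : 0 ≤ x) (hxy : x ≤ y) :
    x * invTail P Y x ≤ y * invTail P Y y :=
  mul_le_mul hxy (invTail_mono h hxy) (zero_le_one.trans (one_le_invTail h x)) (hx.trans hxy)

lemma tendsto_level (h : SlowlyVarying (invTail P Y)) :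
    Tendsto (level (invTail P Y)) atTop atTop := by
  refine tendsto_atTop.2 fun b => ?_
  filter_upwards [eventually_gt_atTop (max b 0 * invTail P Y (max b 0))] with t ht
  refine le_csInf (nonempty_level h t) fun x hx => ?_
  by_contra hlt
  have := mul_invTail_le h hx.1 ((not_le.1 hlt).le.trans (le_max_left b 0))
  linarith [hx.2]

/-- Monotonicity places `2 * l` above and `l / 2` below the crossing of `t`, and slow variation
changes `L` by at most a factor `2` between these points and `l`. Whether the infimum is attained
does not matter. -/
lemma level_bounds (h : SlowlyVarying (invTail P Y)) :
    ∀ᶠ t in atTop, t ≤ 4 * (level (invTail P Y) t * invTail P Y (level (invTail P Y) t)) ∧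
      level (invTail P Y) t * invTail P Y (level (invTail P Y) t) ≤ 4 * t := by
  have hl := tendsto_level h
  have h1 := (hl.eventually ((h 2 two_pos).eventually_le_const (u := 2) (by norm_num)))
  have h2 := (hl.eventually ((h (1 / 2) (by norm_num)).eventually_const_le (u := 1 / 2)
    (by norm_num)))
  filter_upwards [h1, h2, hl.eventually_gt_atTop 0] with t h1 h2 h0
  set l := level (invTail P Y) t with hldef
  have hL : 0 < invTail P Y l := lt_of_lt_of_le one_pos (one_le_invTail h l)
  rw [div_le_iff₀ hL] at h1
  rw [le_div_iff₀ hL] at h2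
  constructor
  · obtain ⟨x, hx, hxl⟩ := exists_lt_of_csInf_lt (nonempty_level h t)
      (show level (invTail P Y) t < l * 2 by linarith)
    have h3 := mul_invTail_le h hx.1 hxl.le
    have h4 := mul_le_mul_of_nonneg_left h1 (show 0 ≤ l * 2 by positivity)
    linarith [hx.2]
  · have h3 : ¬ (0 ≤ l * (1 / 2) ∧ t ≤ l * (1 / 2) * invTail P Y (l * (1 / 2))) :=
      notMem_of_lt_csInf (s := {x : ℝ | 0 ≤ x ∧ t ≤ x * invTail P Y x})
        (show l * (1 / 2) < level (invTail P Y) t by linarith) (bddBelow_level _ t)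
    have h4 : l * (1 / 2) * invTail P Y (l * (1 / 2)) < t := by
      by_contra hc
      exact h3 ⟨by positivity, not_lt.1 hc⟩
    have h5 := mul_le_mul_of_nonneg_left h2 (show 0 ≤ l * (1 / 2) by positivity)
    linarith

end Tail

end

section

/-! ### Good landscapes -/

/-- A landscape in which the traps exceeding `l` near the origin are isolated and very deep, and the
other traps are shallow. -/
structure GoodLandscape (s : ℤ → ℝ) (l K B : ℝ) (M D : ℕ) : Prop where
  pos : ∀ z, 0 < s z
  exists_right : ∃ z ∈ Finset.Icc (1 : ℤ) M, l < s z
  exists_left : ∃ z ∈ Finset.Icc (-M : ℤ) (-1), l < s z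
  origin : s 0 ≤ l
  deep : ∀ z ∈ Finset.Icc (-M : ℤ) M, l < s z → K * l < s z
  isolated : ∀ z ∈ Finset.Icc (-M : ℤ) M, ∀ k ∈ (Finset.Ioo (-D : ℤ) D).erase 0,
    ¬ (l < s z ∧ l < s (z + k))
  shallow : ∑ y ∈ Finset.Icc (-(2 * M) : ℤ) (2 * M), (if s y ≤ l then s y else 0) ≤ B

namespace GoodLandscape

variable {s : ℤ → ℝ} {l K B t : ℝ} {M D : ℕ}

lemma sum_le (h : GoodLandscape s l K B M D) {J : Finset ℤ}
    (hJ : J ⊆ Finset.Icc (-(2 * M) : ℤ) (2 * M)) (hl : ∀ y ∈ J, s y ≤ l) :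
    ∑ y ∈ J, s y ≤ B := by
  refine le_trans ?_ h.shallow
  calc ∑ y ∈ J, s y = ∑ y ∈ J, (if s y ≤ l then s y else 0) :=
        Finset.sum_congr rfl fun y hy => by rw [if_pos (hl y hy)]
    _ ≤ _ := Finset.sum_le_sum_of_subset_of_nonneg hJ fun y _ _ => by
        split_ifs
        · exact (h.pos y).le
        · exact le_rfl

lemma sum_around_le (h : GoodLandscape s l K B M D) (hDM : D ≤ M) {z : ℤ}
    (hz : z ∈ Finset.Icc (-M : ℤ) M) (hlz : l < s z) :
    ∑ y ∈ (Finset.Ioo (z - D) (z + D)).erase z, s y ≤ B := by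
  have hz' := Finset.mem_Icc.1 hz
  refine h.sum_le (fun y hy => ?_) fun y hy => ?_
  · simp only [Finset.mem_erase, Finset.mem_Ioo, Finset.mem_Icc] at hy ⊢
    omega
  · by_contra hly
    refine h.isolated z hz (y - z) ?_ ⟨hlz, by simpa using hly⟩
    simp only [Finset.mem_erase, Finset.mem_Ioo] at hy ⊢
    omega

/-- The sites nearest to the origin with traps exceeding `l` lie within `M`, and every trap strictly
between them is shallow, the origin included. The windows of radius `D ≤ M` around them stay in
`[-2M, 2M]`, where `shallow` applies. -/
theorem le_quenchedProb (h : GoodLandscape s l K B M D) (ht : 0 < t) (hB : 0 < B) (hKl : 0 < K * l)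
    (hD : 0 < D) (hDM : D ≤ M) :
    1 - (4 * M * B / t + 2 * ((4 * B + t / D) / (K * l)))
      ≤ quenchedProb s t (localisationSet s l) := by
  obtain ⟨b0, hb0, hlb0⟩ := h.exists_right
  obtain ⟨a0, ha0, hla0⟩ := h.exists_left
  rw [Finset.mem_Icc] at hb0 ha0
  obtain ⟨b, hb, hbmin⟩ := Int.exists_least_of_bdd (P := fun y => 0 < y ∧ l < s y)
    ⟨0, fun z hz => hz.1.le⟩ ⟨b0, by omega, hlb0⟩
  obtain ⟨a, ha, hamax⟩ := Int.exists_greatest_of_bdd (P := fun y => y < 0 ∧ l < s y)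
    ⟨0, fun z hz => hz.1.le⟩ ⟨a0, by omega, hla0⟩
  have hset : localisationSet s l = {b, a} := by
    have h1 : IsLeast {y : ℤ | 0 < y ∧ l < s y} b := ⟨hb, hbmin⟩
    have h2 : IsGreatest {y : ℤ | y < 0 ∧ l < s y} a := ⟨ha, hamax⟩
    ext z
    constructor
    · rintro (hz | hz)
      · exact Or.inl (hz.unique h1)
      · exact Or.inr (hz.unique h2)
    · rintro (rfl | rfl)
      · exact Or.inl h1
      · exact Or.inr h2
  have hbM : b ≤ M := (hbmin b0 ⟨by omega, hlb0⟩).trans hb0.2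
  have haM : -M ≤ a := ha0.1.trans (hamax a0 ⟨by omega, hla0⟩)
  have hbI : b ∈ Finset.Icc (-M : ℤ) M := Finset.mem_Icc.2 ⟨by omega, hbM⟩
  have haI : a ∈ Finset.Icc (-M : ℤ) M := Finset.mem_Icc.2 ⟨haM, by omega⟩
  have hmain := quenched_localisation h.pos ht ha.1 hb.1 (D := D) (by exact_mod_cast hD) hB
    (h.sum_le (fun y hy => by
        simp only [Finset.mem_Ioo, Finset.mem_Icc] at hy ⊢
        omega) fun y hy => by
        rw [Finset.mem_Ioo] at hy
        by_contra hly
        rw [not_le] at hly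
        rcases lt_trichotomy y 0 with hy0 | rfl | hy0
        · have := hamax y ⟨hy0, hly⟩; omega
        · exact absurd h.origin (not_le.2 hly)
        · have := hbmin y ⟨hy0, hly⟩; omega)
    (h.sum_around_le hDM haI ha.2) (h.sum_around_le hDM hbI hb.2)
  rw [hset]
  refine le_trans ?_ hmain
  have hbM' : (b : ℝ) ≤ M := by exact_mod_cast hbM
  have hnum : 0 ≤ 4 * B + t / (D : ℤ) := by positivity
  have h1 : 4 * b * B / t ≤ 4 * M * B / t := by gcongr
  have h2 : (4 * B + t / (D : ℤ)) / s b ≤ (4 * B + t / (D : ℤ)) / (K * l) :=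
    div_le_div_of_nonneg_left hnum hKl (h.deep b hbI hb.2).le
  have h3 : (4 * B + t / (D : ℤ)) / s a ≤ (4 * B + t / (D : ℤ)) / (K * l) :=
    div_le_div_of_nonneg_left hnum hKl (h.deep a haI ha.2).le
  rw [Int.cast_natCast] at *
  linarith

end GoodLandscape

/-! ### Good landscapes are likely -/

section Environment

variable {Ω : Type*} [MeasurableSpace Ω] {P : Measure Ω} {σ : ℤ → Ω → ℝ}

lemma measureReal_exceed (hi : ∀ z, IdentDistrib (σ z) (σ 0) P P) (z : ℤ) (x : ℝ) :
    P.real {ω | x < σ z ω} = tail P (σ 0) x := by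
  have h := (hi z).measure_mem_eq (measurableSet_Ioi (a := x))
  exact congrArg ENNReal.toReal h

lemma integral_trunc_eq (hi : ∀ z, IdentDistrib (σ z) (σ 0) P P) (z : ℤ) (x : ℝ) :
    ∫ ω, (if σ z ω ≤ x then σ z ω else 0) ∂P = truncMean P (σ 0) x :=
  ((hi z).comp (u := fun y : ℝ => if y ≤ x then y else 0)
    (Measurable.ite measurableSet_Iic measurable_id measurable_const)).integral_eq

lemma measureReal_pair_exceed (hind : iIndepFun σ P) (hi : ∀ z, IdentDistrib (σ z) (σ 0) P P)
    {y z : ℤ} (hyz : y ≠ z) (x : ℝ) :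
    P.real {ω | x < σ y ω ∧ x < σ z ω} = tail P (σ 0) x ^ 2 := by
  have h := (hind.indepFun hyz).measure_inter_preimage_eq_mul (Set.Ioi x) (Set.Ioi x)
    measurableSet_Ioi measurableSet_Ioi
  have h' := congrArg ENNReal.toReal h
  rw [ENNReal.toReal_mul] at h'
  rw [sq]
  nth_rw 1 [← measureReal_exceed hi y x]
  rw [← measureReal_exceed hi z x]
  exact h'

lemma measureReal_close_exceed_le (hind : iIndepFun σ P)
    (hi : ∀ z, IdentDistrib (σ z) (σ 0) P P) (S T : Finset ℤ) (hT : 0 ∉ T) (x : ℝ) :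
    P.real {ω | ∃ z ∈ S, ∃ k ∈ T, x < σ z ω ∧ x < σ (z + k) ω}
      ≤ S.card * (T.card * tail P (σ 0) x ^ 2) := by
  have h1 : {ω | ∃ z ∈ S, ∃ k ∈ T, x < σ z ω ∧ x < σ (z + k) ω}
      = ⋃ z ∈ S, ⋃ k ∈ T, {ω | x < σ z ω ∧ x < σ (z + k) ω} := by
    ext ω; simp only [Set.mem_iUnion, Set.mem_ofPred_eq, exists_prop]
  rw [h1, ← nsmul_eq_mul, ← nsmul_eq_mul]
  refine (measureReal_biUnion_finset_le S _).trans (Finset.sum_le_card_nsmul _ _ _ fun z _ => ?_)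
  refine (measureReal_biUnion_finset_le T _).trans (Finset.sum_le_card_nsmul _ _ _ fun k hk => ?_)
  rw [measureReal_pair_exceed hind hi]
  intro h
  have : k = 0 := by omega
  exact hT (this ▸ hk)

variable [IsProbabilityMeasure P]

lemma measureReal_no_exceed_le (hm : ∀ z, Measurable (σ z)) (hind : iIndepFun σ P)
    (hi : ∀ z, IdentDistrib (σ z) (σ 0) P P) (S : Finset ℤ) (x : ℝ) :
    P.real {ω | ∀ z ∈ S, σ z ω ≤ x} ≤ Real.exp (-(S.card * tail P (σ 0) x)) := by
  have h1 : {ω | ∀ z ∈ S, σ z ω ≤ x} = ⋂ z ∈ S, σ z ⁻¹' Set.Iic x := by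
    ext ω; simp
  have h2 : ∀ z, P.real (σ z ⁻¹' Set.Iic x) = 1 - tail P (σ 0) x := by
    intro z
    rw [← measureReal_exceed hi z x,
      ← probReal_compl_eq_one_sub (measurableSet_lt measurable_const (hm z))]
    congr 1
    ext ω; simp
  have h3 : P.real (⋂ z ∈ S, σ z ⁻¹' Set.Iic x) = ∏ z ∈ S, P.real (σ z ⁻¹' Set.Iic x) := by
    simp only [Measure.real]
    rw [hind.measure_inter_preimage_eq_mul S fun _ _ => measurableSet_Iic, ENNReal.toReal_prod]
  rw [h1, h3]
  simp only [h2, Finset.prod_const]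
  rw [← mul_neg, Real.exp_nat_mul]
  exact pow_le_pow_left₀ (sub_nonneg.2 (tail_le_one x)) (Real.one_sub_le_exp_neg _) _

lemma measureReal_shallow_exceed_le (hm : ∀ z, Measurable (σ z))
    (hi : ∀ z, IdentDistrib (σ z) (σ 0) P P) (S : Finset ℤ) {x y : ℝ} (hxy : x ≤ y) :
    P.real {ω | ∃ z ∈ S, x < σ z ω ∧ σ z ω ≤ y}
      ≤ S.card * (tail P (σ 0) x - tail P (σ 0) y) := by
  have h1 : {ω | ∃ z ∈ S, x < σ z ω ∧ σ z ω ≤ y}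
      = ⋃ z ∈ S, {ω | x < σ z ω ∧ σ z ω ≤ y} := by
    ext ω; simp only [Set.mem_iUnion, Set.mem_ofPred_eq, exists_prop]
  rw [h1, ← nsmul_eq_mul]
  refine (measureReal_biUnion_finset_le S _).trans (Finset.sum_le_card_nsmul _ _ _ fun z _ => ?_)
  rw [measureReal_Ioc_eq (hm z) hxy, tail, tail, measureReal_exceed hi, measureReal_exceed hi]

lemma measureReal_sum_trunc_ge_le (hm : ∀ z, Measurable (σ z)) (hpos : ∀ z, ∀ᵐ ω ∂P, 0 < σ z ω)
    (hi : ∀ z, IdentDistrib (σ z) (σ 0) P P) (S : Finset ℤ) {x B : ℝ} (hx : 0 ≤ x) (hB : 0 < B) :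
    P.real {ω | B ≤ ∑ y ∈ S, (if σ y ω ≤ x then σ y ω else 0)}
      ≤ S.card * truncMean P (σ 0) x / B := by
  have hint : ∀ y ∈ S, Integrable (fun ω => if σ y ω ≤ x then σ y ω else 0) P :=
    fun y _ => integrable_trunc (hm y) (hpos y) hx
  have hnn : 0 ≤ᵐ[P] fun ω => ∑ y ∈ S, (if σ y ω ≤ x then σ y ω else 0) := by
    filter_upwards [ae_all_iff.2 hpos] with ω hω
    refine Finset.sum_nonneg fun y _ => ?_
    split_ifs
    · exact (hω y).le
    · exact le_rfl
  have h := mul_meas_ge_le_integral_of_nonneg hnn (integrable_finsetSum S hint) B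
  rw [integral_finsetSum S hint] at h
  simp only [integral_trunc_eq hi, Finset.sum_const, nsmul_eq_mul] at h
  rw [le_div_iff₀ hB, mul_comm]
  exact h

/-- A union bound over the ways to fail: no exceedance on one side, an exceedance at the origin, one
that is not deep, two that are close, or too much shallow depth (Markov's inequality). -/
lemma measureReal_not_good_le (hm : ∀ z, Measurable (σ z)) (hpos : ∀ z, ∀ᵐ ω ∂P, 0 < σ z ω)
    (hind : iIndepFun σ P) (hi : ∀ z, IdentDistrib (σ z) (σ 0) P P) {l K B : ℝ} (hl : 0 ≤ l)
    (hK : 1 ≤ K) (hB : 0 < B) {M D : ℕ} (hD : 0 < D) :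
    P.real {ω | ¬ GoodLandscape (fun z => σ z ω) l K B M D} ≤
      2 * Real.exp (-(M * tail P (σ 0) l)) + tail P (σ 0) l
      + (2 * M + 1) * (tail P (σ 0) l - tail P (σ 0) (K * l))
      + (2 * M + 1) * (2 * (D - 1) * tail P (σ 0) l ^ 2)
      + (4 * M + 1) * truncMean P (σ 0) l / B := by
  set E1 : Set Ω := {ω | ∀ z ∈ Finset.Icc (1 : ℤ) M, σ z ω ≤ l} with hE1
  set E2 : Set Ω := {ω | ∀ z ∈ Finset.Icc (-M : ℤ) (-1), σ z ω ≤ l} with hE2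
  set E3 : Set Ω := {ω | l < σ 0 ω} with hE3
  set E4 : Set Ω := {ω | ∃ z ∈ Finset.Icc (-M : ℤ) M, l < σ z ω ∧ σ z ω ≤ K * l} with hE4
  set E5 : Set Ω := {ω | ∃ z ∈ Finset.Icc (-M : ℤ) M, ∃ k ∈ (Finset.Ioo (-D : ℤ) D).erase 0,
    l < σ z ω ∧ l < σ (z + k) ω} with hE5
  set E6 : Set Ω := {ω | B ≤ ∑ y ∈ Finset.Icc (-(2 * M) : ℤ) (2 * M),
    (if σ y ω ≤ l then σ y ω else 0)} with hE6
  have hsub : P.real {ω | ¬ GoodLandscape (fun z => σ z ω) l K B M D}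
      ≤ P.real (((((E1 ∪ E2) ∪ E3) ∪ E4) ∪ E5) ∪ E6) := by
    refine ENNReal.toReal_mono (measure_ne_top _ _) (measure_mono_ae ?_)
    filter_upwards [ae_all_iff.2 hpos] with ω hω hbad
    by_contra hnot
    replace hnot : ω ∉ ((((E1 ∪ E2) ∪ E3) ∪ E4) ∪ E5) ∪ E6 := hnot
    simp only [Set.mem_union, not_or, Set.mem_ofPred_eq, hE1, hE2, hE3, hE4, hE5, hE6] at hnot
    obtain ⟨⟨⟨⟨⟨h1, h2⟩, h3⟩, h4⟩, h5⟩, h6⟩ := hnot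
    push Not at h1 h2 h3 h4 h6
    exact hbad ⟨hω, h1, h2, h3, h4, fun z hz k hk h => h5 ⟨z, hz, k, hk, h⟩, h6.le⟩
  have c1 : (Finset.Icc (1 : ℤ) M).card = M := by simp
  have c2 : (Finset.Icc (-M : ℤ) (-1)).card = M := by
    rw [Int.card_Icc]; omega
  have c4 : (Finset.Icc (-M : ℤ) M).card = 2 * M + 1 := by
    rw [Int.card_Icc]; omega
  have c5 : ((Finset.Ioo (-D : ℤ) D).erase 0).card = 2 * (D - 1) := by
    rw [Finset.card_erase_of_mem (Finset.mem_Ioo.2 (by omega)), Int.card_Ioo]; omega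
  have c6 : (Finset.Icc (-(2 * M) : ℤ) (2 * M)).card = 4 * M + 1 := by
    rw [Int.card_Icc]; omega
  have h1 := measureReal_no_exceed_le hm hind hi (Finset.Icc (1 : ℤ) M) l
  have h2 := measureReal_no_exceed_le hm hind hi (Finset.Icc (-M : ℤ) (-1)) l
  have h3 : P.real E3 = tail P (σ 0) l := rfl
  have h4 := measureReal_shallow_exceed_le hm hi (Finset.Icc (-M : ℤ) M)
    (le_mul_of_one_le_left hl hK)
  have h5 := measureReal_close_exceed_le hind hi (Finset.Icc (-M : ℤ) M)
    ((Finset.Ioo (-D : ℤ) D).erase 0) (by simp) l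
  have h6 := measureReal_sum_trunc_ge_le hm hpos hi (Finset.Icc (-(2 * M) : ℤ) (2 * M)) hl hB
  rw [c1] at h1
  rw [c2] at h2
  rw [c4] at h4 h5
  rw [c5] at h5
  rw [c6] at h6
  push_cast [Nat.cast_sub (Nat.one_le_iff_ne_zero.2 hD.ne')] at h4 h5 h6
  have u1 := measureReal_union_le (μ := P) E1 E2
  have u2 := measureReal_union_le (μ := P) (E1 ∪ E2) E3
  have u3 := measureReal_union_le (μ := P) ((E1 ∪ E2) ∪ E3) E4
  have u4 := measureReal_union_le (μ := P) (((E1 ∪ E2) ∪ E3) ∪ E4) E5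
  have u5 := measureReal_union_le (μ := P) ((((E1 ∪ E2) ∪ E3) ∪ E4) ∪ E5) E6
  linarith

end Environment

end

/-! ### Choice of the scales -/

section

section Localisation

variable {Ω : Type*} [MeasurableSpace Ω] {P : Measure Ω} [IsProbabilityMeasure P] {σ : ℤ → Ω → ℝ}

/-- With `q` the probability of exceeding `l`, and radii of order `1 / q`, the landscape is good
with high probability. -/
lemma measureReal_not_good_le_of_scale (hm : ∀ z, Measurable (σ z))
    (hpos : ∀ z, ∀ᵐ ω ∂P, 0 < σ z ω) (hind : iIndepFun σ P)
    (hi : ∀ z, IdentDistrib (σ z) (σ 0) P P) {l K θ R κ δ : ℝ} (hl : 0 < l) (hK : 1 ≤ K)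
    (hθ : 0 < θ) (hR : 1 ≤ R) (hδ : 0 < δ) (hRδ : Real.exp (-R) ≤ δ / 12) (hκ : 0 < κ)
    (hκδ : κ ≤ δ / (60 * R)) (hq : 0 < tail P (σ 0) l) (hqδ : tail P (σ 0) l ≤ δ / 6)
    (hratio : tail P (σ 0) l - tail P (σ 0) (K * l) ≤ δ / (30 * R) * tail P (σ 0) l)
    (htrunc : truncMean P (σ 0) l ≤ θ * δ / (54 * R) * (l * tail P (σ 0) l)) :
    P.real {ω | ¬ GoodLandscape (fun z => σ z ω) l K (θ * l) ⌈R / tail P (σ 0) l⌉₊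
      ⌈κ / tail P (σ 0) l⌉₊} ≤ δ := by
  set q := tail P (σ 0) l with hqdef
  set M := ⌈R / q⌉₊
  set D := ⌈κ / q⌉₊
  have hR0 : 0 < R := one_pos.trans_le hR
  have hq1 : q ≤ 1 := tail_le_one l
  have hD : 0 < D := Nat.ceil_pos.2 (div_pos hκ hq)
  have hM1 : R ≤ M * q := (div_le_iff₀ hq).1 (Nat.le_ceil _)
  have hM2 : M * q ≤ 2 * R := by
    have h1 : (M : ℝ) < R / q + 1 := Nat.ceil_lt_add_one (div_pos hR0 hq).le
    have h2 : M * q ≤ (R / q + 1) * q := mul_le_mul_of_nonneg_right h1.le hq.le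
    have h3 : (R / q + 1) * q = R + q := by field_simp
    linarith
  -- The punctured window has `2 * (D - 1)` points, so the rounding in `D` is harmless even when `κ
  -- / q < 1`.
  have hD2 : (D - 1) * q ≤ κ := by
    have h1 : (D : ℝ) < κ / q + 1 := Nat.ceil_lt_add_one (div_pos hκ hq).le
    exact (le_div_iff₀ hq).1 (by linarith)
  have hD1 : (0 : ℝ) ≤ D - 1 := by
    have : (1 : ℝ) ≤ D := by exact_mod_cast hD
    linarith
  refine (measureReal_not_good_le hm hpos hind hi hl.le hK (mul_pos hθ hl) hD).trans ?_
  rw [← hqdef]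
  have t1 : 2 * Real.exp (-(M * q)) ≤ δ / 6 := by
    have := Real.exp_le_exp.2 (neg_le_neg hM1)
    linarith
  have t3 : (2 * M + 1) * (q - tail P (σ 0) (K * l)) ≤ δ / 6 := by
    calc (2 * M + 1) * (q - tail P (σ 0) (K * l)) ≤ (2 * M + 1) * (δ / (30 * R) * q) := by gcongr
      _ = (2 * (M * q) + q) * (δ / (30 * R)) := by ring
      _ ≤ (5 * R) * (δ / (30 * R)) := by gcongr; linarith
      _ = δ / 6 := by field_simp; norm_num
  have t4 : (2 * M + 1) * (2 * (D - 1) * q ^ 2) ≤ δ / 6 := by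
    calc (2 * M + 1) * (2 * (D - 1) * q ^ 2) = (2 * (M * q) + q) * (2 * ((D - 1) * q)) := by ring
      _ ≤ (5 * R) * (2 * κ) := by
        have := mul_nonneg hD1 hq.le
        gcongr
        linarith
      _ ≤ (5 * R) * (2 * (δ / (60 * R))) := by gcongr
      _ = δ / 6 := by field_simp; norm_num
  have t5 : (4 * M + 1) * truncMean P (σ 0) l / (θ * l) ≤ δ / 6 := by
    rw [div_le_iff₀ (mul_pos hθ hl)]
    calc (4 * M + 1) * truncMean P (σ 0) l
        ≤ (4 * M + 1) * (θ * δ / (54 * R) * (l * q)) := by gcongr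
      _ = (4 * (M * q) + q) * (θ * δ / (54 * R) * l) := by ring
      _ ≤ (9 * R) * (θ * δ / (54 * R) * l) := by gcongr; linarith
      _ = δ / 6 * (θ * l) := by field_simp; norm_num
  linarith

lemma GoodLandscape.le_quenchedProb_of_scale {s : ℤ → ℝ} {l K θ R κ t q : ℝ}
    (h : GoodLandscape s l K (θ * l) ⌈R / q⌉₊ ⌈κ / q⌉₊) (hl : 0 < l) (hK : 1 ≤ K)
    (hθ : 0 < θ) (hR : 1 ≤ R) (hκ : 0 < κ) (hκR : κ ≤ R) (hq : 0 < q) (hq1 : q ≤ 1) (ht : 0 < t)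
    (ht1 : t ≤ 4 * (l * (1 / q))) (ht2 : l * (1 / q) ≤ 4 * t) :
    1 - ((32 * R + 8) * θ + 8 / (κ * K)) ≤ quenchedProb s t (localisationSet s l) := by
  have hD : 0 < ⌈κ / q⌉₊ := Nat.ceil_pos.2 (div_pos hκ hq)
  have hR0 : 0 < R := one_pos.trans_le hR
  have hK0 : 0 < K := one_pos.trans_le hK
  have hDM : ⌈κ / q⌉₊ ≤ ⌈R / q⌉₊ := Nat.ceil_mono (by gcongr)
  refine le_trans ?_ (h.le_quenchedProb ht (mul_pos hθ hl) (mul_pos hK0 hl) hD hDM)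
  set M := ⌈R / q⌉₊
  set D := ⌈κ / q⌉₊
  have hM : (M : ℝ) ≤ 2 * R * (1 / q) := by
    have h1 : (M : ℝ) < R / q + 1 := Nat.ceil_lt_add_one (div_pos hR0 hq).le
    have h2 : 1 ≤ R * (1 / q) := by
      rw [mul_one_div, le_div_iff₀ hq]; linarith
    have h3 : R / q = R * (1 / q) := by ring
    linarith
  have hDκ : κ * (1 / q) ≤ D := by
    rw [mul_one_div]; exact Nat.le_ceil _
  have hD0 : (0 : ℝ) < D := by exact_mod_cast hD
  have e1 : 4 * M * (θ * l) / t ≤ 32 * R * θ := by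
    rw [div_le_iff₀ ht]
    calc 4 * M * (θ * l) ≤ 4 * (2 * R * (1 / q)) * (θ * l) := by gcongr
      _ = 8 * R * θ * (l * (1 / q)) := by ring
      _ ≤ 8 * R * θ * (4 * t) := by gcongr
      _ = 32 * R * θ * t := by ring
  have e2 : t / D ≤ 4 * l / κ := by
    rw [div_le_div_iff₀ hD0 hκ]
    calc t * κ ≤ 4 * (l * (1 / q)) * κ := by gcongr
      _ = 4 * l * (κ * (1 / q)) := by ring
      _ ≤ 4 * l * D := by gcongr
  have e3 : (4 * (θ * l) + t / D) / (K * l) ≤ 4 * θ + 4 / (κ * K) := by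
    rw [div_le_iff₀ (mul_pos hK0 hl)]
    have h1 : (4 * θ + 4 / (κ * K)) * (K * l) = 4 * (θ * l) * K + 4 * l / κ := by field_simp
    have h2 : 4 * (θ * l) ≤ 4 * (θ * l) * K := le_mul_of_one_le_right (by positivity) hK
    linarith
  have e4 : 8 / (κ * K) = 2 * (4 / (κ * K)) := by ring
  linarith

end Localisation

lemma quenchedProb_le_one (s : ℤ → ℝ) (t : ℝ) (A : Set ℤ) : quenchedProb s t A ≤ 1 :=
  measureReal_le_one

end

end Bouchaud

end

theorem theorem1 {Ω : Type*} [MeasurableSpace Ω] (P : Measure Ω) [IsProbabilityMeasure P]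
    (σ : ℤ → Ω → ℝ)
    (hσ_meas : ∀ z, Measurable (σ z))
    (hσ_pos : ∀ z, ∀ᵐ ω ∂P, 0 < σ z ω)
    (hσ_indep : iIndepFun σ P)
    (hσ_ident : ∀ z, IdentDistrib (σ z) (σ 0) P P)
    (hσ_slow : Bouchaud.SlowlyVarying (Bouchaud.invTail P (σ 0))) :
    TendstoInMeasure P
      (fun (t : ℝ) (ω : Ω) =>
        Bouchaud.quenchedProb (fun z => σ z ω) t
          (Bouchaud.localisationSet (fun z => σ z ω)
            (Bouchaud.level (Bouchaud.invTail P (σ 0)) t)))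
      atTop (fun _ => 1) := by
  open Bouchaud in
  rw [tendstoInMeasure_iff_measureReal_dist]
  intro ε hε
  rw [Metric.tendsto_nhds]
  intro δ' hδ'
  set δ := δ' / 2 with hδdef
  have hδ : 0 < δ := by positivity
  obtain ⟨R, hRδ, hR⟩ : ∃ R : ℝ, Real.exp (-R) ≤ δ / 12 ∧ 1 ≤ R :=
    ((Real.tendsto_exp_neg_atTop_nhds_zero.eventually_le_const
      (by positivity : (0 : ℝ) < δ / 12)).and (eventually_ge_atTop 1)).exists
  have hR0 : 0 < R := one_pos.trans_le hR
  -- The constants are chosen in the order `R`, `κ`, `θ`, `K`. The bound `κ ≤ R` ensures `D ≤ M`,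
  -- and `κ ≤ δ / (60 * R)` makes close pairs of exceedances unlikely.
  set κ := min R (δ / (60 * R)) with hκdef
  have hκ : 0 < κ := lt_min hR0 (by positivity)
  -- With `θ` and `K` so chosen, the two error terms of `le_quenchedProb_of_scale` are at most `ε /
  -- 4` each.
  set θ := ε / (4 * (32 * R + 8)) with hθdef
  have hθ : 0 < θ := by positivity
  set K := max 1 (32 / (κ * ε)) with hKdef
  have hK : 1 ≤ K := le_max_left _ _
  have hK0 : 0 < K := one_pos.trans_le hK
  have hlev := tendsto_level hσ_slow
  have hratio := (tendsto_tail_ratio hσ_slow hK0).eventually_const_le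
    (u := 1 - δ / (30 * R)) (by have : 0 < δ / (30 * R) := by positivity
                                linarith)
  have htail := (tendsto_tail (P := P) (hσ_meas 0)).eventually_le_const
    (by positivity : (0 : ℝ) < δ / 6)
  have htrunc := truncMean_isLittleO (hσ_meas 0) (hσ_pos 0) hσ_slow
    (by positivity : 0 < θ * δ / (54 * R))
  filter_upwards [hlev.eventually hratio, hlev.eventually htail, hlev.eventually htrunc,
    hlev.eventually_gt_atTop 0, level_bounds hσ_slow, eventually_gt_atTop 0]
    with t hratio htail htrunc hl hbounds ht
  set l := level (invTail P (σ 0)) t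
  have hq := tail_pos hσ_slow l
  rw [le_div_iff₀ hq] at hratio
  have hgood := measureReal_not_good_le_of_scale hσ_meas hσ_pos hσ_indep hσ_ident hl hK hθ hR hδ
    hRδ hκ (min_le_right _ _) hq htail (by rw [mul_comm K l]; linarith) htrunc
  rw [Real.dist_eq, sub_zero, abs_of_nonneg measureReal_nonneg]
  refine lt_of_le_of_lt (le_trans (measureReal_mono ?_) hgood) (by linarith)
  -- On a good landscape the quenched probability is at least `1 - ε / 2`, so a deviation of `ε`
  -- forces a bad one.
  intro ω hω hgoodω
  have hquenched := hgoodω.le_quenchedProb_of_scale hl hK hθ hR hκ (min_le_left _ _) hq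
    (tail_le_one l) ht hbounds.1 hbounds.2
  have hle := quenchedProb_le_one (fun z => σ z ω) t (localisationSet (fun z => σ z ω) l)
  have h1 : (32 * R + 8) * θ = ε / 4 := by rw [hθdef]; field_simp
  have h2 : 8 / (κ * K) ≤ ε / 4 := by
    have h3 : 32 / (κ * ε) ≤ K := le_max_right _ _
    rw [div_le_iff₀ (by positivity)] at h3
    rw [div_le_iff₀ (by positivity)]
    linarith
  rw [Set.mem_ofPred_eq, Real.dist_eq, abs_sub_comm, abs_of_nonneg (sub_nonneg.2 hle)] at hω
  linarith
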